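/- \textbf{Theorem.} For positive integers $n,k,a$ with $k \mid n$, consider the following $(a:a)$ Maker--Breaker $S_k$-factor game. The board is the edge set $E(K_n)$ of the complete graph on $n$ vertices. The game is played in rounds: in each round first Breaker and then Maker claims $a$ previously unclaimed edges (or all the unclaimed edges, if fewer than $a$ are left). Maker wins as soon as the edges claimed by her contain all the edges of an $S_k$-factor of $K_n$, that is, of a collection of pairwise vertex-disjoint stars, each with one centre and $k-1$ leaves, which together cover all $n$ vertices. Let $\tau_{k,n}(a:a)$ be the least $t$ such that Maker has a strategy with which she wins within $t$ rounds against every play of Breaker (and $\infty$ if there is no such $t$). Let $a\ge 1$ and $k\ge 3$ be integers. Then there is $n_0=n_0(a,k)$ such that for every $n\ge n_0$ with $k\mid n$, $$ \tau_{k,n}(a:a)\;\le\; \begin{cases} \left\lceil \dfrac{(k-1)n}{ka}\right\rceil, & \text{if } a\nmid \dfrac{(k-1)n}{k},\\[3mm] \dfrac{(k-1)n}{ka}+1, & \text{otherwise.} \end{cases} $$ -/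

import Mathlib

/-! ### Maker-Breaker games on a finite board, with Breaker moving first -/

namespace MakerBreaker

variable {α : Type*} [DecidableEq α]

/-- A legal move of a player with bias `a`: exactly `a` previously unclaimed elements of the board,
or all the unclaimed elements if fewer than `a` are left. -/
def IsLegalMove (a : ℕ) (free move : Finset α) : Prop :=
  move ⊆ free ∧ move.card = min a free.card

/-- A (deterministic) strategy of Maker: it maps the list of all moves that Breaker has made so far,
in chronological order, to Maker's next move. (Maker's own earlier moves are determined by
the strategy and by Breaker's earlier moves.) -/
abbrev Strategy (α : Type*) := List (Finset α) → Finset α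

/-- The move Maker makes in round `i` (rounds are numbered `0, 1, 2, …`) when she follows `σ` and
Breaker's move in each round `j` is `b j`. -/
def makerMove (σ : Strategy α) (b : ℕ → Finset α) (i : ℕ) : Finset α :=
  σ ((List.range (i + 1)).map b)

/-- The elements claimed by Maker in the first `t` rounds. -/
def makerSet (σ : Strategy α) (b : ℕ → Finset α) (t : ℕ) : Finset α :=
  (Finset.range t).biUnion (makerMove σ b)

/-- The elements claimed by Breaker in the first `t` rounds. -/
def breakerSet (b : ℕ → Finset α) (t : ℕ) : Finset α :=
  (Finset.range t).biUnion b

/-- Breaker, who has bias `q` and opens each round, moves legally in round `i`. -/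
def BreakerLegalAt (X : Finset α) (q : ℕ) (σ : Strategy α) (b : ℕ → Finset α) (i : ℕ) : Prop :=
  IsLegalMove q (X \ (makerSet σ b i ∪ breakerSet b i)) (b i)

/-- Maker, who has bias `p` and answers Breaker's move, moves legally in round `i`. -/
def MakerLegalAt (X : Finset α) (p : ℕ) (σ : Strategy α) (b : ℕ → Finset α) (i : ℕ) : Prop :=
  IsLegalMove p (X \ (makerSet σ b i ∪ breakerSet b (i + 1))) (makerMove σ b i)

/-- `σ` obeys the rules of the `(p : q)` game on the board `X`: as long as Breaker has moved
legally, Maker's answer is legal. -/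
def IsLegalStrategy (X : Finset α) (p q : ℕ) (σ : Strategy α) : Prop :=
  ∀ (b : ℕ → Finset α) (i : ℕ),
    (∀ j ≤ i, BreakerLegalAt X q σ b j) → MakerLegalAt X p σ b i

/-- In the `(p : q)` game `(X, 𝓕)` with Breaker moving first, Maker has a strategy with which,
however Breaker plays, she has claimed all the elements of some winning set after at most `t`
rounds. -/
def MakerWinsWithin (X : Finset α) (𝓕 : Set (Finset α)) (p q t : ℕ) : Prop :=
  ∃ σ : Strategy α, IsLegalStrategy X p q σ ∧
    ∀ b : ℕ → Finset α, (∀ j < t, BreakerLegalAt X q σ b j) → ∃ F ∈ 𝓕, F ⊆ makerSet σ b t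

/-- The duration `τ_𝓕(p : q)`: the least `t` such that Maker has a strategy to win within `t`
moves, and `⊤` if there is no such `t`. -/
noncomputable def duration (X : Finset α) (𝓕 : Set (Finset α)) (p q : ℕ) : ℕ∞ :=
  ⨅ (t : ℕ) (_ : MakerWinsWithin X 𝓕 p q t), (t : ℕ∞)

end MakerBreaker

/-- `S_k`: the star with one centre and `k - 1` leaves (for `k ≥ 1`). -/
abbrev starS (k : ℕ) : SimpleGraph (Fin 1 ⊕ Fin (k - 1)) :=
  completeBipartiteGraph (Fin 1) (Fin (k - 1))

/-- `E` is the edge set of an `H`-factor of `G`: there are finitely many pairwise vertex-disjoint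
copies of `H` in `G` which together cover every vertex of `G`, and `E` consists of the edges of
these copies. -/
def IsFactorEdgeSet {V W : Type*} (H : SimpleGraph W) (G : SimpleGraph V)
    (E : Finset (Sym2 V)) : Prop :=
  ∃ (m : ℕ) (f : Fin m → SimpleGraph.Copy H G),
    Function.Bijective (fun p : Fin m × W => f p.1 p.2) ∧
    (E : Set (Sym2 V)) = ⋃ i, Sym2.map (f i) '' H.edgeSet

/-- The duration `τ(a : a)` of the `(a : a)` Maker-Breaker `S_k`-factor game on `E(K_n)`. -/
noncomputable def starFactorDuration (n k a : ℕ) : ℕ∞ :=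
  MakerBreaker.duration (⊤ : SimpleGraph (Fin n)).edgeFinset
    {E | IsFactorEdgeSet (starS k) (⊤ : SimpleGraph (Fin n)) E} a a

/-! Fix in advance which `m = n / k` vertices are centres (`C`); the others are leaves (`L`), and
with `κ = k - 1` there are `κ * m` of them. Maker only cares about pairs in `C × L`. Her plan is an
assignment `f : L → C` with `κ` leaves at each centre: she owns `(f v, v)` for all covered leaves
`v`, while on the uncovered set `U` the assignment is tentative and may be permuted. Nearly every
edge must be useful, so the problem is to keep Breaker from ruining the end.

Opening: Maker covers at once every leaf that Breaker touches, so no Breaker pair meets `U`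
(`Opening.canReply`). Middle game, for a bounded number of rounds: a potential counts twice the
leaves still to be given to centres that should not stay open, plus the Breaker pairs between open
centres and uncovered leaves. Breaker adds at most `a` per round and Maker removes `2 * a`
(`exists_potential_le`). At the end `r` pairs are missing, `1 ≤ r ≤ a`, none of them is blocked
under any rearrangement, and the open centres have low Breaker degree.

Endgame: after Breaker's next move some cyclic shift of `f` on `U` has `e` blocked pairs with `r * e
≤ a` (`exists_shift`), and each blocked pair is repaired by a switch costing one extra edge
(`Balanced.exists_unblocked`). If `r < a`, then `r + e ≤ a` and one round suffices. If `r = a`,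
Maker takes all but one pair and repairs the last in the next round; for `a = 1` she creates a
double threat instead (`Fork`), which is where `k ≥ 3` matters. -/

namespace MakerBreaker

variable {α : Type*} [DecidableEq α]

/-! ### Strategies from invariants of the position. -/

omit [DecidableEq α] in
/-- A set of at most `a` free elements extends to a legal move. -/
theorem exists_isLegalMove_superset {a : ℕ} {free s : Finset α} (hs : s ⊆ free)
    (hcard : s.card ≤ a) : ∃ s', s ⊆ s' ∧ IsLegalMove a free s' := by
  obtain ⟨s', h1, h2, h3⟩ := Finset.exists_subsuperset_card_eq hs
    (le_min hcard (Finset.card_le_card hs)) (min_le_right a free.card)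
  exact ⟨s', h1, h2, h3⟩

/-- A position of a game in which Maker answers with `g i M B` in round `i`, together with
Maker's last move. -/
structure Position (α : Type*) where
  round : ℕ
  maker : Finset α
  breaker : Finset α
  last : Finset α

/-- The position after Breaker's move `b` and Maker's answer. -/
def Position.next (g : ℕ → Finset α → Finset α → Finset α) (P : Position α) (b : Finset α) :
    Position α :=
  ⟨P.round + 1, P.maker ∪ g P.round P.maker (P.breaker ∪ b), P.breaker ∪ b,
    g P.round P.maker (P.breaker ∪ b)⟩

/-- The position reached after the given moves of Breaker. -/
def positionAfter (g : ℕ → Finset α → Finset α → Finset α) (l : List (Finset α)) : Position α :=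
  l.foldl (Position.next g) ⟨0, ∅, ∅, ∅⟩

/-- The strategy that answers according to the position. -/
def positional (g : ℕ → Finset α → Finset α → Finset α) : Strategy α :=
  fun l => (positionAfter g l).last

theorem positionAfter_range_succ (g : ℕ → Finset α → Finset α → Finset α) (b : ℕ → Finset α)
    (i : ℕ) : positionAfter g ((List.range (i + 1)).map b) =
      (positionAfter g ((List.range i).map b)).next g (b i) := by
  simp [positionAfter, List.range_succ]

theorem makerSet_succ (σ : Strategy α) (b : ℕ → Finset α) (i : ℕ) :
    makerSet σ b (i + 1) = makerSet σ b i ∪ makerMove σ b i := by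
  simp [makerSet, Finset.range_add_one, Finset.biUnion_insert, Finset.union_comm]

theorem breakerSet_succ (b : ℕ → Finset α) (i : ℕ) :
    breakerSet b (i + 1) = breakerSet b i ∪ b i := by
  simp [breakerSet, Finset.range_add_one, Finset.biUnion_insert, Finset.union_comm]

theorem positionAfter_eq (g : ℕ → Finset α → Finset α → Finset α) (b : ℕ → Finset α) (i : ℕ) :
    (positionAfter g ((List.range i).map b)).round = i ∧
    (positionAfter g ((List.range i).map b)).maker = makerSet (positional g) b i ∧
    (positionAfter g ((List.range i).map b)).breaker = breakerSet b i := by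
  induction i with
  | zero => simp [positionAfter, makerSet, breakerSet]
  | succ i ih =>
    obtain ⟨h1, h2, h3⟩ := ih
    have hm : makerMove (positional g) b i =
        ((positionAfter g ((List.range i).map b)).next g (b i)).last := by
      rw [← positionAfter_range_succ]; rfl
    refine ⟨?_, ?_, ?_⟩
    · rw [positionAfter_range_succ, Position.next, h1]
    · rw [makerSet_succ, hm, ← h2, positionAfter_range_succ]; rfl
    · rw [breakerSet_succ, ← h3, positionAfter_range_succ]; rfl

theorem makerMove_positional (g : ℕ → Finset α → Finset α → Finset α) (b : ℕ → Finset α) (i : ℕ) :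
    makerMove (positional g) b i =
      g i (makerSet (positional g) b i) (breakerSet b (i + 1)) := by
  obtain ⟨h1, h2, h3⟩ := positionAfter_eq g b i
  have hm : makerMove (positional g) b i =
      ((positionAfter g ((List.range i).map b)).next g (b i)).last := by
    rw [← positionAfter_range_succ]; rfl
  rw [hm, Position.next, h1, h2, h3, ← breakerSet_succ]

/-- Maker wins within `t` rounds if she can maintain an invariant of the position that
after `t` rounds forces a winning set. -/
theorem makerWinsWithin_of_invariant {X : Finset α} {𝓕 : Set (Finset α)} {a t : ℕ}
    (I : ℕ → Finset α → Finset α → Prop) (h0 : I 0 ∅ ∅)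
    (hstep : ∀ i < t, ∀ M B b, I i M B → IsLegalMove a (X \ (M ∪ B)) b →
      ∃ s, IsLegalMove a (X \ (M ∪ (B ∪ b))) s ∧ I (i + 1) (M ∪ s) (B ∪ b))
    (hend : ∀ M B, I t M B → ∃ F ∈ 𝓕, F ⊆ M) : MakerWinsWithin X 𝓕 a a t := by
  classical
  have hlegal : ∀ M B : Finset α, ∃ s, IsLegalMove a (X \ (M ∪ B)) s := fun M B => by
    obtain ⟨s, -, hs⟩ := exists_isLegalMove_superset (a := a)
      (Finset.empty_subset (X \ (M ∪ B))) (by simp)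
    exact ⟨s, hs⟩
  -- Here `B` already contains Breaker's latest move. The fallback branch keeps the strategy legal
  -- even where the invariant has been lost.
  let g : ℕ → Finset α → Finset α → Finset α := fun i M B =>
    if h : ∃ s, IsLegalMove a (X \ (M ∪ B)) s ∧ I (i + 1) (M ∪ s) B then h.choose
    else (hlegal M B).choose
  have hg1 : ∀ i M B, IsLegalMove a (X \ (M ∪ B)) (g i M B) := fun i M B => by
    by_cases h : ∃ s, IsLegalMove a (X \ (M ∪ B)) s ∧ I (i + 1) (M ∪ s) B
    · simp only [g, dif_pos h]; exact h.choose_spec.1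
    · simp only [g, dif_neg h]; exact (hlegal M B).choose_spec
  have hg2 : ∀ i M B, (∃ s, IsLegalMove a (X \ (M ∪ B)) s ∧ I (i + 1) (M ∪ s) B) →
      I (i + 1) (M ∪ g i M B) B := fun i M B h => by
    simp only [g, dif_pos h]; exact h.choose_spec.2
  refine ⟨positional g, fun b i _ => ?_, fun b hb => ?_⟩
  · rw [MakerLegalAt, makerMove_positional]; exact hg1 _ _ _
  · have key : ∀ i ≤ t, I i (makerSet (positional g) b i) (breakerSet b i) := by
      intro i
      induction i with
      | zero => intro _; simpa [makerSet, breakerSet] using h0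
      | succ i ih =>
        intro hi
        rw [makerSet_succ, makerMove_positional]
        apply hg2
        rw [breakerSet_succ]
        exact hstep i hi _ _ _ (ih (by omega)) (hb i hi)
    exact hend _ _ (key t le_rfl)

/-- The criterion `makerWinsWithin_of_invariant` for a Maker who only looks at the part of the
board that is the image of `e`. -/
theorem makerWinsWithin_of_invariant_embedding {P : Type*} [Fintype P] [DecidableEq P]
    {X : Finset α} {𝓕 : Set (Finset α)} {a t : ℕ} (e : P ↪ α) (he : ∀ p, e p ∈ X)
    (I : ℕ → Finset P → Finset P → Prop) (h0 : I 0 ∅ ∅)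
    (hstep : ∀ i < t, ∀ M B b, I i M B → Disjoint M B → b.card ≤ a → Disjoint M b →
      ∃ s, s.card ≤ a ∧ Disjoint s M ∧ Disjoint s (B ∪ b) ∧
        ∀ s', s ⊆ s' → s'.card ≤ a → Disjoint s' M → Disjoint s' (B ∪ b) →
          I (i + 1) (M ∪ s') (B ∪ b))
    (hend : ∀ M B, I t M B → ∃ F ∈ 𝓕, F ⊆ M.map e) : MakerWinsWithin X 𝓕 a a t := by
  let pull : Finset α → Finset P := fun S => Finset.univ.filter fun p => e p ∈ S
  have hpull : ∀ S p, p ∈ pull S ↔ e p ∈ S := by simp [pull]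
  have hunion : ∀ S T, pull (S ∪ T) = pull S ∪ pull T := fun S T => by
    ext p; simp [hpull]
  have hdisj : ∀ S T, Disjoint S T → Disjoint (pull S) (pull T) := fun S T h => by
    rw [Finset.disjoint_left] at h ⊢
    intro p hp hq
    exact h ((hpull _ _).1 hp) ((hpull _ _).1 hq)
  have hcard : ∀ S, (pull S).card ≤ S.card := fun S => by
    rw [← Finset.card_map e]
    apply Finset.card_le_card
    intro x hx
    obtain ⟨p, hp, rfl⟩ := Finset.mem_map.1 hx
    exact (hpull _ _).1 hp
  refine makerWinsWithin_of_invariant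
    (fun i M B => Disjoint M B ∧ I i (pull M) (pull B)) ?_ ?_ ?_
  · simpa [pull] using h0
  · rintro i hi M B b ⟨hMB, hI⟩ ⟨hb1, hb2⟩
    have hMb : Disjoint M b := by
      rw [Finset.disjoint_left]
      intro x hx hxb
      have := hb1 hxb
      simp [hx] at this
    have hbc : b.card ≤ a := hb2 ▸ min_le_left _ _
    obtain ⟨s, hs1, hs2, hs3, hs4⟩ := hstep i hi _ _ (pull b) hI (hdisj _ _ hMB)
      ((hcard b).trans hbc) (hdisj _ _ hMb)
    -- The rules force a full move, so the useful edges are padded arbitrarily; this is why the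
    -- invariant must survive every superset `s'` of `s`.
    obtain ⟨s', hs', hleg⟩ := exists_isLegalMove_superset (a := a)
      (free := X \ (M ∪ (B ∪ b))) (s := s.map e) (by
        intro x hx
        obtain ⟨p, hp, rfl⟩ := Finset.mem_map.1 hx
        have h1 := Finset.disjoint_left.1 hs2 hp
        have h2 := Finset.disjoint_left.1 hs3 hp
        rw [← hunion, hpull] at h2
        rw [hpull] at h1
        simp only [Finset.mem_sdiff, Finset.mem_union] at h2 ⊢
        exact ⟨he p, by tauto⟩) (by simpa using hs1)
    have hd1 : Disjoint s' M := by
      rw [Finset.disjoint_left]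
      intro x hx hxM
      have := hleg.1 hx
      simp [hxM] at this
    have hd2 : Disjoint s' (B ∪ b) := by
      rw [Finset.disjoint_left]
      intro x hx hxB
      exact (Finset.mem_sdiff.1 (hleg.1 hx)).2 (Finset.mem_union_right _ hxB)
    refine ⟨s', hleg, ?_, ?_⟩
    · rw [Finset.disjoint_union_left]
      exact ⟨Finset.disjoint_union_right.2 ⟨hMB, hMb⟩, hd2⟩
    · rw [hunion, hunion]
      refine hs4 _ ?_ ?_ (hdisj _ _ hd1) (hunion B b ▸ hdisj _ _ hd2)
      · intro p hp
        exact (hpull _ _).2 (hs' (Finset.mem_map_of_mem e hp))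
      · exact (hcard s').trans (hleg.2 ▸ min_le_left _ _)
  · rintro M B ⟨-, hI⟩
    obtain ⟨F, hF, hFM⟩ := hend _ _ hI
    refine ⟨F, hF, hFM.trans ?_⟩
    intro x hx
    obtain ⟨p, hp, rfl⟩ := Finset.mem_map.1 hx
    exact (hpull _ _).1 hp

end MakerBreaker

namespace StarFactor

variable {C L : Type*} [Fintype C] [Fintype L] [DecidableEq C] [DecidableEq L]

/-! ### Balanced assignments and covering leaves one at a time. -/

/-- The number of vertices of `U` that `f` assigns to the centre `c`. -/
def demand (f : L → C) (U : Finset L) (c : C) : ℕ := (U.filter fun v => f v = c).card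

/-- Every centre has exactly `κ` leaves assigned. -/
def Balanced (κ : ℕ) (f : L → C) : Prop := ∀ c, demand f Finset.univ c = κ

/-- The pairs `(f v, v)` with `v ∈ S`. -/
def graphOn (f : L → C) (S : Finset L) : Finset (C × L) := S.image fun v => (f v, v)

/-- The number of pairs of `B` with centre `c`. -/
def cdeg (B : Finset (C × L)) (c : C) : ℕ := (B.filter fun p => p.1 = c).card

/-- The number of pairs of `B` with leaf `v`. -/
def ldeg (B : Finset (C × L)) (v : L) : ℕ := (B.filter fun p => p.2 = v).card

omit [Fintype C] [Fintype L] in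
theorem mem_graphOn {f : L → C} {S : Finset L} {p : C × L} :
    p ∈ graphOn f S ↔ p.2 ∈ S ∧ f p.2 = p.1 := by
  simp only [graphOn, Finset.mem_image]
  constructor
  · rintro ⟨v, hv, rfl⟩; exact ⟨hv, rfl⟩
  · rintro ⟨h1, h2⟩; exact ⟨p.2, h1, by rw [h2]⟩

omit [Fintype C] [Fintype L] in
theorem card_graphOn (f : L → C) (S : Finset L) : (graphOn f S).card = S.card :=
  Finset.card_image_of_injective _ fun _ _ h => (Prod.ext_iff.1 h).2

omit [Fintype C] [Fintype L] in
theorem cdeg_union_le (B b : Finset (C × L)) (c : C) : cdeg (B ∪ b) c ≤ cdeg B c + b.card := by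
  unfold cdeg
  rw [Finset.filter_union]
  exact (Finset.card_union_le _ _).trans (Nat.add_le_add_left (Finset.card_filter_le _ _) _)

omit [Fintype C] [Fintype L] in
theorem ldeg_union_le (B b : Finset (C × L)) (v : L) : ldeg (B ∪ b) v ≤ ldeg B v + b.card := by
  unfold ldeg
  rw [Finset.filter_union]
  exact (Finset.card_union_le _ _).trans (Nat.add_le_add_left (Finset.card_filter_le _ _) _)

omit [Fintype L] [DecidableEq L] in
theorem sum_cdeg (B : Finset (C × L)) : ∑ c, cdeg B c = B.card :=
  (Finset.card_eq_sum_card_fiberwise fun _ _ => Finset.mem_univ _).symm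

omit [Fintype L] [DecidableEq L] in
theorem sum_demand (f : L → C) (U : Finset L) : ∑ c, demand f U c = U.card :=
  (Finset.card_eq_sum_card_fiberwise fun _ _ => Finset.mem_univ _).symm

omit [Fintype C] [Fintype L] [DecidableEq L] in
theorem demand_mono (f : L → C) {U V : Finset L} (h : U ⊆ V) (c : C) :
    demand f U c ≤ demand f V c :=
  Finset.card_le_card (Finset.filter_subset_filter _ h)

omit [Fintype C] [Fintype L] [DecidableEq L] in
theorem demand_comp_perm (f : L → C) {U : Finset L} (π : Equiv.Perm L)
    (hπ : ∀ x, π x ∈ U ↔ x ∈ U) (c : C) : demand (f ∘ π) U c = demand f U c := by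
  refine Finset.card_equiv π fun x => ?_
  simp [hπ]

omit [Fintype C] [DecidableEq L] in
theorem Balanced.comp_perm {κ : ℕ} {f : L → C} (hf : Balanced κ f) (π : Equiv.Perm L) :
    Balanced κ (f ∘ π) := fun c => by
  rw [demand_comp_perm f π (by simp), hf c]

omit [Fintype C] [Fintype L] [DecidableEq L] in
theorem demand_pos {f : L → C} {U : Finset L} {v : L} (hv : v ∈ U) : 0 < demand f U (f v) :=
  Finset.card_pos.2 ⟨v, by simp [hv]⟩

omit [Fintype C] [Fintype L] in
theorem demand_erase (f : L → C) {U : Finset L} {v : L} (hv : v ∈ U) (c : C) :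
    demand f (U.erase v) c = demand f U c - if c = f v then 1 else 0 := by
  unfold demand
  rw [Finset.filter_erase]
  split_ifs with h
  · rw [Finset.card_erase_of_mem (by simp [hv, h])]
  · rw [Finset.erase_eq_of_notMem (by simp [Ne.symm h, hv]), Nat.sub_zero]

/-- `f'` arises from `f` by covering the vertex `v` of `U` from the centre `c`. -/
structure Covers (f f' : L → C) (U : Finset L) (v : L) (c : C) : Prop where
  apply_eq : f' v = c
  agree : ∀ x ∉ U, f' x = f x
  demand_eq : ∀ c', demand f' (U.erase v) c' = demand f U c' - if c' = c then 1 else 0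

-- Exchange `v` with some `w ∈ U` that is tentatively assigned to `c`. Hence, for uncovered leaves,
-- only the demands of the centres matter and not the values of `f`.
omit [Fintype C] in
theorem Balanced.exists_covers {κ : ℕ} {f : L → C} (hf : Balanced κ f) {U : Finset L} {v : L}
    (hv : v ∈ U) {c : C} (hc : 0 < demand f U c) :
    ∃ f', Balanced κ f' ∧ Covers f f' U v c := by
  obtain ⟨w, hw⟩ := Finset.card_pos.1 hc
  obtain ⟨hwU, hwc⟩ := Finset.mem_filter.1 hw
  have hswap : ∀ x, Equiv.swap v w x ∈ U ↔ x ∈ U := fun x => by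
    rcases eq_or_ne x v with rfl | hxv
    · simp [hv, hwU]
    rcases eq_or_ne x w with rfl | hxw
    · simp [hv, hwU]
    rw [Equiv.swap_apply_of_ne_of_ne hxv hxw]
  have hfv : (f ∘ Equiv.swap v w) v = c := by simp [hwc]
  refine ⟨f ∘ Equiv.swap v w, hf.comp_perm _, hfv, fun x hx => ?_, fun c' => ?_⟩
  · have h1 : x ≠ v := fun h => hx (h ▸ hv)
    have h2 : x ≠ w := fun h => hx (h ▸ hwU)
    simp [Equiv.swap_apply_of_ne_of_ne h1 h2]
  · rw [demand_erase _ hv, demand_comp_perm f _ hswap, hfv]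

omit [Fintype C] [Fintype L] in
theorem Covers.demand_le {f f' : L → C} {U : Finset L} {v : L} {c : C} (h : Covers f f' U v c)
    (c' : C) : demand f' (U.erase v) c' ≤ demand f U c' := by
  rw [h.demand_eq]; exact Nat.sub_le _ _

omit [Fintype C] in
/-- Covering `a` vertices of `U` one by one while maintaining `Q`. -/
theorem exists_cover_iterate {κ a : ℕ} {B : Finset (C × L)} (Q : ℕ → (L → C) → Finset L → Prop)
    (hstep : ∀ j < a, ∀ f U, Q j f U → ∃ v ∈ U, ∃ c, 0 < demand f U c ∧ (c, v) ∉ B ∧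
      ∀ f', Covers f f' U v c → Q (j + 1) f' (U.erase v))
    {f : L → C} {U : Finset L} (hf : Balanced κ f) (hB : ∀ x ∉ U, (f x, x) ∉ B) (h0 : Q 0 f U) :
    ∃ f' U', Balanced κ f' ∧ U' ⊆ U ∧ (∀ x ∉ U, f' x = f x) ∧ U.card = U'.card + a ∧
      (∀ x ∉ U', (f' x, x) ∉ B) ∧ Q a f' U' := by
  suffices H : ∀ j ≤ a, ∃ f' U', Balanced κ f' ∧ U' ⊆ U ∧ (∀ x ∉ U, f' x = f x) ∧
      U.card = U'.card + j ∧ (∀ x ∉ U', (f' x, x) ∉ B) ∧ Q j f' U' from H a le_rfl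
  intro j
  induction j with
  | zero => exact fun _ => ⟨f, U, hf, subset_rfl, fun _ _ => rfl, rfl, hB, h0⟩
  | succ j ih =>
    intro hj
    obtain ⟨g, V, hg, hVU, hag, hcard, hgB, hQ⟩ := ih (by omega)
    obtain ⟨v, hv, c, hc, hcv, hnext⟩ := hstep j (by omega) g V hQ
    obtain ⟨g', hg', hcov⟩ := hg.exists_covers hv hc
    refine ⟨g', V.erase v, hg', (Finset.erase_subset _ _).trans hVU, fun x hx => ?_, ?_,
      fun x hx => ?_, hnext g' hcov⟩
    · rw [hcov.agree x fun h => hx (hVU h), hag x hx]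
    · rw [Finset.card_erase_of_mem hv]
      have := Finset.card_pos.2 ⟨v, hv⟩
      omega
    · by_cases hxv : x = v
      · rwa [hxv, hcov.apply_eq]
      · have hxV : x ∉ V := fun h => hx (Finset.mem_erase.2 ⟨hxv, h⟩)
        rw [hcov.agree x hxV]; exact hgB x hxV

/-- Maker, owning `M`, can claim at most `a` pairs outside `M` and `B` such that `I` holds
whichever further pairs she gets. -/
def CanReply (a : ℕ) (M B : Finset (C × L)) (I : Finset (C × L) → Prop) : Prop :=
  ∃ s : Finset (C × L), s.card ≤ a ∧ Disjoint s M ∧ Disjoint s B ∧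
    ∀ s', s ⊆ s' → s'.card ≤ a → Disjoint s' M → Disjoint s' B → I (M ∪ s')

-- The new pairs use up the whole bias, so no padding is possible and `s' = s`.
omit [Fintype C] in
theorem canReply_of_extension {a : ℕ} {f f' : L → C} {U U' : Finset L} {B : Finset (C × L)}
    {I : Finset (C × L) → Prop} (hU : U' ⊆ U) (hf : ∀ x ∉ U, f' x = f x)
    (hcard : U.card = U'.card + a) (hB : ∀ x ∉ U', (f' x, x) ∉ B) (hI : I (graphOn f' U'ᶜ)) :
    CanReply a (graphOn f Uᶜ) B I := by
  have hs : (graphOn f' (U \ U')).card = a := by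
    rw [card_graphOn, Finset.card_sdiff_of_subset hU]; omega
  refine ⟨graphOn f' (U \ U'), hs.le, ?_, ?_, fun s' h1 h2 _ _ => ?_⟩
  · rw [Finset.disjoint_left]
    intro p hp hq
    rw [mem_graphOn] at hp hq
    simp only [Finset.mem_sdiff, Finset.mem_compl] at hp hq
    exact hq.1 hp.1.1
  · rw [Finset.disjoint_left]
    intro p hp
    rw [mem_graphOn] at hp
    have := hB p.2 (Finset.mem_sdiff.1 hp.1).2
    rwa [hp.2] at this
  · rw [← Finset.eq_of_subset_of_card_le h1 (by rw [hs]; exact h2)]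
    convert hI using 1
    ext p
    simp only [Finset.mem_union, mem_graphOn, Finset.mem_sdiff, Finset.mem_compl]
    by_cases hp : p.2 ∈ U
    · simp [hp]
    · have hp' : p.2 ∉ U' := fun h => hp (hU h)
      simp [hp, hf p.2 hp, hp']

omit [Fintype C] [Fintype L] in
theorem notMem_of_disjoint_graphOn {f : L → C} {S : Finset L} {B : Finset (C × L)}
    (h : Disjoint (graphOn f S) B) {x : L} (hx : x ∈ S) : (f x, x) ∉ B :=
  Finset.disjoint_left.1 h (mem_graphOn.2 ⟨hx, rfl⟩)

omit [Fintype L] [DecidableEq L] in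
/-- Few active centres cannot have all of the demand. -/
theorem card_le_mul_card_active {κ : ℕ} {f : L → C} {U : Finset L}
    (hκ : ∀ c, demand f U c ≤ κ) :
    U.card ≤ (Finset.univ.filter fun c => 0 < demand f U c).card * κ := by
  rw [← sum_demand f U, ← Finset.sum_filter_add_sum_filter_not Finset.univ
    (fun c => 0 < demand f U c)]
  rw [Finset.sum_eq_zero (s := Finset.univ.filter fun c => ¬ 0 < demand f U c)
    (by simp), add_zero]
  exact Finset.sum_le_card_nsmul _ _ _ fun c _ => hκ c

omit [Fintype C] [Fintype L] in
theorem exists_mem_notMem_of_ldeg_lt {B : Finset (C × L)} {v : L} {A : Finset C}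
    (h : ldeg B v < A.card) : ∃ c ∈ A, (c, v) ∉ B := by
  by_contra! hall
  refine absurd h (not_lt.2 ?_)
  refine Finset.card_le_card_of_injOn (fun c => (c, v)) (fun c hc => ?_) fun c _ d _ h => ?_
  · simp [hall c hc]
  · exact (Prod.ext_iff.1 h).1

/-! ### The opening. -/

/-- The number of centres that lack at least two leaves. -/
def heavy (f : L → C) (U : Finset L) : Finset C := Finset.univ.filter fun c => 2 ≤ demand f U c

/-- The invariant of the opening: no pair of Breaker meets an uncovered leaf, and as long as there
are more than `a` centres which lack two leaves no star is complete. -/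
def Opening (κ a i : ℕ) (M B : Finset (C × L)) : Prop :=
  ∃ (f : L → C) (U : Finset L), M = graphOn f Uᶜ ∧ Balanced κ f ∧
    U.card + a * i = Fintype.card L ∧ B.card ≤ a * i ∧ (∀ v ∈ U, ∀ c, (c, v) ∉ B) ∧
    ((heavy f U).card ≤ a ∨ ∀ c, 1 ≤ demand f U c)

theorem opening_zero {κ a : ℕ} (hκ : 1 ≤ κ) {f : L → C} (hf : Balanced κ f) :
    Opening κ a 0 (∅ : Finset (C × L)) ∅ := by
  refine ⟨f, Finset.univ, by simp [graphOn], hf, by simp, by simp, by simp, Or.inr fun c => ?_⟩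
  rw [hf c]; exact hκ

omit [Fintype L] in
theorem heavy_card_le_of_covers {f f' : L → C} {U : Finset L} {v : L} {c : C}
    (h : Covers f f' U v c) : (heavy f' (U.erase v)).card ≤ (heavy f U).card := by
  refine Finset.card_le_card fun d hd => ?_
  simp only [heavy, Finset.mem_filter, Finset.mem_univ, true_and] at hd ⊢
  exact hd.trans (h.demand_le d)

/-- The uncovered leaves that meet a pair of Breaker. -/
def touched (B : Finset (C × L)) (U : Finset L) : Finset L := U.filter fun v => ∃ c, (c, v) ∈ B

/-- Breaker's move touches at most `a` uncovered leaves, each of Breaker degree at most `a`, so any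
set of more than `a` centres offers a free partner. Taking it among the heavy centres, while there
are more than `a` of these, completes no star. -/
theorem Opening.canReply {κ a i : ℕ} {M B b : Finset (C × L)}
    (hN : a * (i + 1) + a * κ ≤ Fintype.card L) (h : Opening κ a i M B)
    (hMB : Disjoint M B) (hb : b.card ≤ a) (hMb : Disjoint M b) :
    CanReply a M (B ∪ b) fun M' => Opening κ a (i + 1) M' (B ∪ b) := by
  obtain ⟨f, U, rfl, hf, hcard, hBcard, hfresh, hheavy⟩ := h
  have hdisj := Finset.disjoint_union_right.2 ⟨hMB, hMb⟩
  have hdeg : ∀ v ∈ U, ldeg (B ∪ b) v ≤ a := fun v hv => by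
    refine (ldeg_union_le B b v).trans ?_
    have : ldeg B v = 0 := by
      rw [ldeg, Finset.card_eq_zero, Finset.filter_eq_empty_iff]
      rintro ⟨c, w⟩ hp rfl
      exact hfresh _ hv c hp
    omega
  have htouched : (touched (B ∪ b) U).card ≤ a := by
    refine le_trans ?_ hb
    refine (Finset.card_le_card (t := b.image Prod.snd) fun v hv => ?_).trans Finset.card_image_le
    obtain ⟨hvU, c, hc⟩ := Finset.mem_filter.1 hv
    rcases Finset.mem_union.1 hc with hc | hc
    · exact absurd hc (hfresh v hvU c)
    · exact Finset.mem_image.2 ⟨(c, v), hc, rfl⟩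
  have hle : ∀ c, demand f U c ≤ κ := fun c => hf c ▸ demand_mono f (Finset.subset_univ U) c
  have hmul : a * (i + 1) = a * i + a := by ring
  let Q : ℕ → (L → C) → Finset L → Prop := fun j g V => V.card + j = U.card ∧
    (∀ v ∈ V, ldeg (B ∪ b) v ≤ a) ∧ (touched (B ∪ b) V).card ≤ a - j ∧
    ((heavy g V).card ≤ a ∨ ∀ c, 1 ≤ demand g V c) ∧ ∀ c, demand g V c ≤ κ
  have hstep : ∀ j < a, ∀ g V, Q j g V → ∃ v ∈ V, ∃ c, 0 < demand g V c ∧ (c, v) ∉ B ∪ b ∧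
      ∀ g', Covers g g' V v c → Q (j + 1) g' (V.erase v) := by
    intro j hj g V hQ
    obtain ⟨hV, hdegV, htV, hhV, hleV⟩ := hQ
    obtain ⟨v, hvV, hv⟩ : ∃ v ∈ V, v ∈ touched (B ∪ b) V ∨ touched (B ∪ b) V = ∅ := by
      rcases (touched (B ∪ b) V).eq_empty_or_nonempty with he | ⟨v, hv⟩
      · have : 0 < V.card := by omega
        obtain ⟨v, hv⟩ := Finset.card_pos.1 this
        exact ⟨v, hv, Or.inr he⟩
      · exact ⟨v, (Finset.mem_filter.1 hv).1, Or.inl hv⟩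
    -- By `hN`, more than `a * κ` leaves are still uncovered, and each centre accounts for at most
    -- `κ`.
    have hactive : a < (Finset.univ.filter fun c => 0 < demand g V c).card := by
      have h1 := card_le_mul_card_active hleV
      by_contra! h2
      have := Nat.mul_le_mul_right κ h2
      omega
    have hc : ∃ c, 0 < demand g V c ∧ (c, v) ∉ B ∪ b ∧
        ((heavy g V).card ≤ a ∨ 2 ≤ demand g V c) := by
      by_cases hh : (heavy g V).card ≤ a
      · obtain ⟨c, hc, hcv⟩ := exists_mem_notMem_of_ldeg_lt ((hdegV v hvV).trans_lt hactive)
        exact ⟨c, (Finset.mem_filter.1 hc).2, hcv, Or.inl hh⟩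
      · obtain ⟨c, hc, hcv⟩ :=
          exists_mem_notMem_of_ldeg_lt ((hdegV v hvV).trans_lt (not_le.1 hh))
        have h2 := (Finset.mem_filter.1 hc).2
        exact ⟨c, by omega, hcv, Or.inr h2⟩
    obtain ⟨c, hc0, hcv, hc2⟩ := hc
    refine ⟨v, hvV, c, hc0, hcv, fun g' hg' => ⟨?_, ?_, ?_, ?_, ?_⟩⟩
    · rw [Finset.card_erase_of_mem hvV]
      have := Finset.card_pos.2 ⟨v, hvV⟩
      omega
    · exact fun w hw => hdegV w (Finset.mem_of_mem_erase hw)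
    · have hsub : touched (B ∪ b) (V.erase v) = (touched (B ∪ b) V).erase v :=
        Finset.filter_erase _ _ _
      rw [hsub]
      rcases hv with hv | hv
      · rw [Finset.card_erase_of_mem hv]; omega
      · simp [hv]
    · rcases hhV with hh | hh
      · exact Or.inl ((heavy_card_le_of_covers hg').trans hh)
      rcases hc2 with h2 | h2
      · exact Or.inl ((heavy_card_le_of_covers hg').trans h2)
      refine Or.inr fun d => ?_
      rw [hg'.demand_eq]
      split_ifs with hd
      · subst hd; omega
      · exact hh d
    · exact fun d => (hg'.demand_le d).trans (hleV d)
  obtain ⟨f', U', hf', hU', hag, hcard', hB', -, -, hQ3, hQ4, -⟩ := exists_cover_iterate Q hstep hf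
    (fun x hx => notMem_of_disjoint_graphOn hdisj (by simpa using hx))
    ⟨rfl, hdeg, htouched, hheavy, hle⟩
  refine canReply_of_extension hU' hag hcard' hB' ⟨f', U', rfl, hf', ?_, ?_, ?_, hQ4⟩
  · omega
  · have := Finset.card_union_le B b
    omega
  · intro v hv c hc
    rw [Nat.sub_self, Nat.le_zero, Finset.card_eq_zero] at hQ3
    exact Finset.notMem_empty v (hQ3 ▸ Finset.mem_filter.2 ⟨hv, c, hc⟩)

/-! ### The middle game. -/

/-- The number of leaves that have to be given to the centres before each centre in `G` lacks at
most one leaf and every other centre lacks none. -/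
def excess (f : L → C) (U : Finset L) (G : Finset C) : ℕ :=
  ∑ c, (demand f U c - if c ∈ G then 1 else 0)

/-- The pairs of Breaker between an active centre and an uncovered leaf. -/
def danger (f : L → C) (U : Finset L) (B : Finset (C × L)) : Finset (C × L) :=
  B.filter fun p => p.2 ∈ U ∧ 0 < demand f U p.1

/-- The potential that Maker drives to zero in the middle game. -/
def potential (f : L → C) (U : Finset L) (B : Finset (C × L)) (G : Finset C) : ℕ :=
  2 * excess f U G + (danger f U B).card

omit [Fintype L] in
theorem excess_le_of_covers {f f' : L → C} {U : Finset L} {v : L} {c : C}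
    (h : Covers f f' U v c) (G : Finset C) : excess f' (U.erase v) G ≤ excess f U G :=
  Finset.sum_le_sum fun d _ => Nat.sub_le_sub_right (h.demand_le d) _

omit [Fintype C] [Fintype L] in
theorem danger_subset_of_covers {f f' : L → C} {U : Finset L} {v : L} {c : C}
    (h : Covers f f' U v c) (B : Finset (C × L)) : danger f' (U.erase v) B ⊆ danger f U B := by
  intro p hp
  simp only [danger, Finset.mem_filter] at hp ⊢
  exact ⟨hp.1, Finset.mem_of_mem_erase hp.2.1, hp.2.2.trans_le (h.demand_le _)⟩

omit [Fintype C] [Fintype L] in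
theorem danger_card_of_covers {f f' : L → C} {U : Finset L} {v : L} {c : C}
    (h : Covers f f' U v c) {B K : Finset (C × L)} (hc : demand f U c ≤ 1)
    (hK : K ⊆ danger f U B) (hkill : ∀ p ∈ K, p.1 = c ∨ p.2 = v) :
    (danger f' (U.erase v) B).card ≤ (danger f U B).card - K.card := by
  rw [← Finset.card_sdiff_of_subset hK]
  refine Finset.card_le_card fun p hp => Finset.mem_sdiff.2
    ⟨danger_subset_of_covers h B hp, fun hpK => ?_⟩
  simp only [danger, Finset.mem_filter, Finset.mem_erase] at hp
  rcases hkill p hpK with hpc | hpv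
  · have := hp.2.2
    rw [hpc, h.demand_eq, if_pos rfl] at this
    omega
  · exact hp.2.1.1 hpv

omit [Fintype L] in
/-- Maker can lower the potential by two with every edge. -/
theorem exists_potential_le (f : L → C) (U : Finset L) (B : Finset (C × L)) (G : Finset C)
    (hlt : potential f U B G < U.card) :
    ∃ v ∈ U, ∃ c, 0 < demand f U c ∧ (c, v) ∉ B ∧
      ∀ f', Covers f f' U v c → potential f' (U.erase v) B G ≤ potential f U B G - 2 := by
  have hdlt : (danger f U B).card < U.card := lt_of_le_of_lt (Nat.le_add_left _ _) hlt
  have hfreeL : ∀ c, 0 < demand f U c → ∃ v ∈ U, (c, v) ∉ B := fun c hc => by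
    by_contra! hall
    refine absurd hdlt (not_lt.2 ?_)
    refine Finset.card_le_card_of_injOn (fun v => (c, v)) (fun v hv => ?_) fun v _ w _ h => ?_
    · simp [danger, hall v hv, hc, Finset.mem_coe.1 hv]
    · exact (Prod.ext_iff.1 h).2
  -- With no excess, every open centre lacks exactly one leaf, so one edge closes both a centre and
  -- a leaf and has to destroy two dangerous pairs. With positive excess, a free edge at a centre
  -- contributing to it already lowers the doubled term by two.
  rcases Nat.eq_zero_or_pos (excess f U G) with hW | hW
  · have hdem : ∀ c, demand f U c ≤ 1 := fun c => by
      have := (Finset.sum_eq_zero_iff.1 hW) c (Finset.mem_univ c)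
      split_ifs at this <;> omega
    have hfreeC : ∀ v ∈ U, ∃ c, 0 < demand f U c ∧ (c, v) ∉ B := fun v hv => by
      by_contra! hall
      refine absurd hdlt (not_lt.2 ?_)
      have h1 := card_le_mul_card_active hdem
      rw [mul_one] at h1
      refine h1.trans ?_
      refine Finset.card_le_card_of_injOn (fun c => (c, v)) (fun c hc => ?_) fun c _ d _ h => ?_
      · have hc' : 0 < demand f U c := by simpa using hc
        simp [danger, hall c hc', hc', hv]
      · exact (Prod.ext_iff.1 h).1
    suffices H : ∃ v ∈ U, ∃ c, 0 < demand f U c ∧ (c, v) ∉ B ∧ ∃ K ⊆ danger f U B,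
        (∀ p ∈ K, p.1 = c ∨ p.2 = v) ∧ min 2 (danger f U B).card ≤ K.card by
      obtain ⟨v, hv, c, hc, hcv, K, hK, hkill, hKc⟩ := H
      refine ⟨v, hv, c, hc, hcv, fun f' hf' => ?_⟩
      have h1 := danger_card_of_covers hf' (hdem c) hK hkill
      have h2 := excess_le_of_covers hf' G
      unfold potential
      omega
    rcases (danger f U B).eq_empty_or_nonempty with he | ⟨p, hp⟩
    · obtain ⟨v, hv⟩ := Finset.card_pos.1 (by omega : 0 < U.card)
      obtain ⟨c, hc, hcv⟩ := hfreeC v hv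
      exact ⟨v, hv, c, hc, hcv, ∅, by simp, by simp, by simp [he]⟩
    have hmem : ∀ q ∈ danger f U B, q ∈ B ∧ q.2 ∈ U ∧ 0 < demand f U q.1 := fun q hq => by
      simpa [danger] using hq
    have hp' := hmem p hp
    rcases Nat.lt_or_ge (danger f U B).card 2 with hlt2 | hge2
    · obtain ⟨c, hc, hcv⟩ := hfreeC p.2 hp'.2.1
      refine ⟨p.2, hp'.2.1, c, hc, hcv, {p}, by simpa using hp, by simp, ?_⟩
      rw [Finset.card_singleton]; omega
    · obtain ⟨q, hq, hqp⟩ := Finset.exists_mem_ne (s := danger f U B) (by omega) p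
      have hq' := hmem q hq
      have two : ∀ x ∈ danger f U B, ∀ y ∈ danger f U B, x ≠ y → ∀ v ∈ U, ∀ c,
          0 < demand f U c → (c, v) ∉ B → (x.1 = c ∨ x.2 = v) → (y.1 = c ∨ y.2 = v) →
          ∃ v ∈ U, ∃ c, 0 < demand f U c ∧ (c, v) ∉ B ∧ ∃ K ⊆ danger f U B,
          (∀ p ∈ K, p.1 = c ∨ p.2 = v) ∧ min 2 (danger f U B).card ≤ K.card := by
        intro x hx y hy hxy v hv c hc hcv h1 h2
        refine ⟨v, hv, c, hc, hcv, {x, y}, ?_, ?_, ?_⟩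
        · intro z hz
          rcases Finset.mem_insert.1 hz with rfl | hz
          · exact hx
          · rwa [Finset.mem_singleton.1 hz]
        · intro z hz
          rcases Finset.mem_insert.1 hz with rfl | hz
          · exact h1
          · rwa [Finset.mem_singleton.1 hz]
        · rw [Finset.card_pair hxy]; exact min_le_left _ _
      -- If the cross pair is free, claiming it destroys both `p` and `q`. Otherwise either `p` and
      -- `q` share a centre, or the cross pair is itself dangerous and shares the leaf `q.2` with
      -- `q`; closing the shared vertex destroys two pairs.
      by_cases hfree : (p.1, q.2) ∈ B
      · have hx : (p.1, q.2) ∈ danger f U B := by simp [danger, hfree, hp'.2.2, hq'.2.1]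
        by_cases hpq : p.1 = q.1
        · obtain ⟨v, hv, hcv⟩ := hfreeL p.1 hp'.2.2
          exact two p hp q hq hqp.symm v hv p.1 hp'.2.2 hcv (Or.inl rfl) (Or.inl hpq.symm)
        · obtain ⟨c, hc, hcv⟩ := hfreeC q.2 hq'.2.1
          exact two _ hx q hq (fun h => hpq (Prod.ext_iff.1 h).1) q.2 hq'.2.1 c hc hcv
            (Or.inr rfl) (Or.inr rfl)
      · exact two p hp q hq hqp.symm q.2 hq'.2.1 p.1 hp'.2.2 hfree (Or.inl rfl) (Or.inr rfl)
  · obtain ⟨c, -, hc⟩ := Finset.exists_ne_zero_of_sum_ne_zero hW.ne'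
    have hc0 : 0 < demand f U c := by omega
    obtain ⟨v, hv, hcv⟩ := hfreeL c hc0
    refine ⟨v, hv, c, hc0, hcv, fun f' hf' => ?_⟩
    have h1 := Finset.card_le_card (danger_subset_of_covers hf' B)
    have h2 : excess f' (U.erase v) G < excess f U G := by
      refine Finset.sum_lt_sum (fun d _ => Nat.sub_le_sub_right (hf'.demand_le d) _)
        ⟨c, Finset.mem_univ c, ?_⟩
      rw [hf'.demand_eq, if_pos rfl]
      omega
    unfold potential
    omega

omit [Fintype L] in
theorem potential_union_le (f : L → C) (U : Finset L) (B b : Finset (C × L)) (G : Finset C) :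
    potential f U (B ∪ b) G ≤ potential f U B G + b.card := by
  unfold potential danger
  rw [Finset.filter_union]
  have h1 := Finset.card_union_le (B.filter fun p => p.2 ∈ U ∧ 0 < demand f U p.1)
    (b.filter fun p => p.2 ∈ U ∧ 0 < demand f U p.1)
  have h2 := Finset.card_filter_le b fun p => p.2 ∈ U ∧ 0 < demand f U p.1
  omega

/-- The invariant of the middle game, `i` rounds into it. The number of uncovered leaves at its
beginning is `R` and at its end it is `r`. -/
def Middle (κ a d r R i : ℕ) (M B : Finset (C × L)) : Prop :=
  ∃ (f : L → C) (U : Finset L) (G : Finset C), M = graphOn f Uᶜ ∧ Balanced κ f ∧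
    U.card + a * i = R ∧ (∀ c ∈ G, cdeg B c ≤ d + a * i) ∧ (∀ v ∈ U, ldeg B v ≤ a * i) ∧
    potential f U B G ≤ U.card - r - a

/-- The potential has a net loss of `a` per round, as does its bound `U.card - r - a`. The bound is
zero once `U.card = r`. -/
theorem Middle.canReply {κ a d r R i : ℕ} {M B b : Finset (C × L)} (hr : 1 ≤ r)
    (hR : a * (i + 1) + r ≤ R) (h : Middle κ a d r R i M B)
    (hMB : Disjoint M B) (hb : b.card ≤ a) (hMb : Disjoint M b) :
    CanReply a M (B ∪ b) fun M' => Middle κ a d r R (i + 1) M' (B ∪ b) := by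
  obtain ⟨f, U, G, rfl, hf, hcard, hG, hL, hpot⟩ := h
  have hdisj := Finset.disjoint_union_right.2 ⟨hMB, hMb⟩
  have hmul : a * (i + 1) = a * i + a := by ring
  have hpot' := potential_union_le f U B b G
  let Q : ℕ → (L → C) → Finset L → Prop := fun j g V => V.card + j = U.card ∧
    potential g V (B ∪ b) G ≤ U.card - r - 2 * j
  have hstep : ∀ j < a, ∀ g V, Q j g V → ∃ v ∈ V, ∃ c, 0 < demand g V c ∧ (c, v) ∉ B ∪ b ∧
      ∀ g', Covers g g' V v c → Q (j + 1) g' (V.erase v) := by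
    rintro j hj g V ⟨hV, hp⟩
    -- The potential is at most `U.card - r - 2 * j`, which is below `V.card = U.card - j` because
    -- `r ≥ 1`.
    obtain ⟨v, hv, c, hc, hcv, hnext⟩ := exists_potential_le g V (B ∪ b) G (by omega)
    refine ⟨v, hv, c, hc, hcv, fun g' hg' => ⟨?_, ?_⟩⟩
    · rw [Finset.card_erase_of_mem hv]
      have := Finset.card_pos.2 ⟨v, hv⟩
      omega
    · have := hnext g' hg'
      omega
  obtain ⟨f', U', hf', hU', hag, hcard', hB', -, hQ⟩ := exists_cover_iterate Q hstep hf
    (fun x hx => notMem_of_disjoint_graphOn hdisj (by simpa using hx))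
    ⟨rfl, by omega⟩
  refine canReply_of_extension hU' hag hcard' hB' ⟨f', U', G, rfl, hf', by omega, ?_, ?_, ?_⟩
  · intro c hc
    have h1 := cdeg_union_le B b c
    have h2 := hG c hc
    omega
  · intro v hv
    have h1 := ldeg_union_le B b v
    have h2 := hL v (hU' hv)
    omega
  · omega

/-- At the end of the opening the middle game can begin. -/
theorem Opening.middle {κ a d r R i : ℕ} {M B : Finset (C × L)} (h : Opening κ a i M B)
    (hL : Fintype.card L = κ * Fintype.card C) (hi : R + a * i = Fintype.card L)
    (hRC : R < Fintype.card C) (hd : Fintype.card C ≤ 4 * d)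
    (hR : 2 * ((4 * κ + a) * κ) + a + r ≤ R) : Middle κ a d r R 0 M B := by
  obtain ⟨f, U, rfl, hf, hcard, hBcard, hfresh, hheavy⟩ := h
  have hU : U.card = R := by omega
  -- Since `R < |C|`, some centre is complete, which rules out the second alternative.
  have hh : (heavy f U).card ≤ a := by
    rcases hheavy with h | h
    · exact h
    · have h1 := Finset.card_nsmul_le_sum Finset.univ (demand f U) 1 fun c _ => h c
      rw [sum_demand, Finset.card_univ, smul_eq_mul] at h1
      omega
  -- Breaker has at most `κ * |C|` pairs and `d ≥ |C| / 4`, so at most `4 * κ` centres are bad. `G`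
  -- is the complement, and only bad or heavy centres contribute to the excess.
  let bad : Finset C := Finset.univ.filter fun c => d < cdeg B c
  have hbad : bad.card ≤ 4 * κ := by
    have h1 : bad.card * d ≤ B.card := by
      rw [← sum_cdeg B]
      refine le_trans ?_ (Finset.sum_le_sum_of_subset (Finset.subset_univ bad))
      rw [← smul_eq_mul]
      exact Finset.card_nsmul_le_sum _ _ _ fun c hc => (Finset.mem_filter.1 hc).2.le
    have hd0 : 0 < d := by omega
    refine le_of_mul_le_mul_right ?_ hd0
    calc bad.card * d ≤ κ * Fintype.card C := by omega
      _ ≤ κ * (4 * d) := Nat.mul_le_mul_left _ hd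
      _ = 4 * κ * d := by ring
  have hexc : excess f U badᶜ ≤ (4 * κ + a) * κ := by
    have h1 : excess f U badᶜ ≤ ∑ c ∈ bad ∪ heavy f U, κ := by
      unfold excess
      rw [← Finset.sum_subset (Finset.subset_univ (bad ∪ heavy f U))]
      · exact Finset.sum_le_sum fun c _ => (Nat.sub_le _ _).trans
          (hf c ▸ demand_mono f (Finset.subset_univ U) c)
      · intro c _ hc
        simp only [Finset.mem_union, not_or] at hc
        rw [if_pos (Finset.mem_compl.2 hc.1)]
        have := hc.2
        simp only [heavy, Finset.mem_filter, Finset.mem_univ, true_and] at this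
        omega
    rw [Finset.sum_const, smul_eq_mul] at h1
    refine h1.trans (Nat.mul_le_mul_right _ ((Finset.card_union_le _ _).trans ?_))
    omega
  have hdanger : (danger f U B).card = 0 := by
    rw [Finset.card_eq_zero, danger, Finset.filter_eq_empty_iff]
    rintro ⟨c, v⟩ hp ⟨hv, -⟩
    exact hfresh v hv c hp
  refine ⟨f, U, badᶜ, rfl, hf, by omega, ?_, ?_, ?_⟩
  · intro c hc
    simp only [bad, Finset.mem_compl, Finset.mem_filter, Finset.mem_univ, true_and, not_lt] at hc
    omega
  · intro v hv
    rw [mul_zero, Nat.le_zero, ldeg, Finset.card_eq_zero, Finset.filter_eq_empty_iff]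
    rintro ⟨c, w⟩ hp rfl
    exact hfresh _ hv c hp
  · unfold potential
    omega

end StarFactor

namespace StarFactor

variable {C L : Type*} [Fintype C] [Fintype L] [DecidableEq C] [DecidableEq L]

/-! ### Repairing blocked pairs by switches and shifts. -/

omit [Fintype L] in
theorem exists_switch_centre (f : L → C) {B : Finset (C × L)} {v : L} {c : C}
    (h : 1 + ldeg B v + cdeg B c < Fintype.card C) :
    ∃ c', c' ≠ c ∧ (c', v) ∉ B ∧ ∀ u, f u = c' → (c, u) ∉ B := by
  -- The forbidden centres: `c` itself, those blocked to `v`, and those having an assigned leaf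
  -- blocked to `c`.
  let S : Finset C := insert c (((B.filter fun p => p.2 = v).image Prod.fst) ∪
    (B.filter fun p => p.1 = c).image fun p => f p.2)
  have hS : S.card < (Finset.univ : Finset C).card := by
    have h1 := Finset.card_insert_le c (((B.filter fun p => p.2 = v).image Prod.fst) ∪
      (B.filter fun p => p.1 = c).image fun p => f p.2)
    have h2 := Finset.card_union_le ((B.filter fun p => p.2 = v).image Prod.fst)
      ((B.filter fun p => p.1 = c).image fun p => f p.2)
    have h3 : ((B.filter fun p => p.2 = v).image Prod.fst).card ≤ ldeg B v :=
      Finset.card_image_le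
    have h4 : ((B.filter fun p => p.1 = c).image fun p => f p.2).card ≤ cdeg B c :=
      Finset.card_image_le
    rw [Finset.card_univ]
    simp only [S]
    omega
  obtain ⟨c', -, hc'⟩ := Finset.exists_mem_notMem_of_card_lt_card hS
  simp only [S, Finset.mem_insert, Finset.mem_union, not_or, Finset.mem_image,
    Finset.mem_filter, not_exists, not_and] at hc'
  refine ⟨c', hc'.1, fun hp => hc'.2.1 (c', v) ⟨hp, rfl⟩ rfl, fun u hu hp => ?_⟩
  exact hc'.2.2 (c, u) ⟨hp, rfl⟩ hu

/-- The vertices whose assigned pair belongs to `B`. -/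
def blocked (f : L → C) (U : Finset L) (B : Finset (C × L)) : Finset L :=
  U.filter fun v => (f v, v) ∈ B

/-- Every blocked vertex can be repaired by exchanging it with one further vertex. -/
theorem Balanced.exists_unblocked {κ : ℕ} (hκ : 1 ≤ κ) {B : Finset (C × L)} {f : L → C}
    (hf : Balanced κ f) (hdeg : ∀ v ∈ blocked f Finset.univ B,
      1 + ldeg B v + cdeg B (f v) < Fintype.card C) :
    ∃ (f' : L → C) (S : Finset L), Balanced κ f' ∧ (∀ x, (f' x, x) ∉ B) ∧
      S.card ≤ (blocked f Finset.univ B).card ∧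
      ∀ x ∉ blocked f Finset.univ B ∪ S, f' x = f x := by
  induction hn : (blocked f Finset.univ B).card using Nat.strong_induction_on generalizing f with
  | _ n ih =>
    subst hn
    rcases (blocked f Finset.univ B).eq_empty_or_nonempty with he | ⟨v, hv⟩
    · refine ⟨f, ∅, hf, fun x hx => ?_, by simp, fun _ _ => rfl⟩
      exact Finset.notMem_empty x (he ▸ Finset.mem_filter.2 ⟨Finset.mem_univ _, hx⟩)
    -- Give `v` to `c'` and in return any leaf `u` of `c'` to the old centre of `v`. Neither new
    -- pair is blocked, so the number of blocked vertices drops, and only `u` joins `S`.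
    obtain ⟨c', hc', hc'v, hfree⟩ := exists_switch_centre f (hdeg v hv)
    obtain ⟨u, hu⟩ := Finset.card_pos.1 (by rw [← demand, hf c']; exact hκ :
      0 < (Finset.univ.filter fun u => f u = c').card)
    have hfu := (Finset.mem_filter.1 hu).2
    have huv : u ≠ v := fun h => hc' (by rw [← hfu, h])
    have hv1 : (f ∘ Equiv.swap u v) v = c' := by simp [hfu]
    have hu1 : (f ∘ Equiv.swap u v) u = f v := by simp
    have hx1 : ∀ x, x ≠ u → x ≠ v → (f ∘ Equiv.swap u v) x = f x := fun x h1 h2 => by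
      simp [Equiv.swap_apply_of_ne_of_ne h1 h2]
    have hne : ∀ x ∈ blocked (f ∘ Equiv.swap u v) Finset.univ B, x ≠ u ∧ x ≠ v := by
      intro x hx
      have hxB := (Finset.mem_filter.1 hx).2
      constructor
      · rintro rfl
        rw [hu1] at hxB
        exact hfree x hfu hxB
      · rintro rfl
        rw [hv1] at hxB
        exact hc'v hxB
    have hsub : blocked (f ∘ Equiv.swap u v) Finset.univ B ⊆
        (blocked f Finset.univ B).erase v := by
      intro x hx
      obtain ⟨h1, h2⟩ := hne x hx
      have hxB := (Finset.mem_filter.1 hx).2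
      rw [hx1 x h1 h2] at hxB
      exact Finset.mem_erase.2 ⟨h2, Finset.mem_filter.2 ⟨Finset.mem_univ _, hxB⟩⟩
    have hle := Finset.card_le_card hsub
    have hpos := Finset.card_pos.2 ⟨v, hv⟩
    rw [Finset.card_erase_of_mem hv] at hle
    obtain ⟨f', S, hf', hB, hS, hagree⟩ := ih _ (by omega) (hf.comp_perm (Equiv.swap u v))
      (fun x hx => by
        obtain ⟨h1, h2⟩ := hne x hx
        rw [hx1 x h1 h2]
        exact hdeg x (Finset.mem_of_mem_erase (hsub hx))) rfl
    refine ⟨f', insert u S, hf', hB, ?_, fun x hx => ?_⟩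
    · have := Finset.card_insert_le u S
      omega
    · simp only [Finset.mem_union, Finset.mem_insert, not_or] at hx
      have hxv : x ≠ v := fun h => hx.1 (h ▸ hv)
      rw [hagree x, hx1 x hx.2.1 hxv]
      rw [Finset.mem_union, not_or]
      exact ⟨fun h => hx.1 (Finset.mem_of_mem_erase (hsub h)), hx.2.2⟩

omit [Fintype C] [Fintype L] in
/-- Some cyclic shift of the assignment on `U` has at most the average number of blocked
vertices. -/
theorem exists_shift (f : L → C) (U : Finset L) (B : Finset (C × L)) :
    ∃ π : Equiv.Perm L, (∀ x ∉ U, π x = x) ∧ (∀ x, π x ∈ U ↔ x ∈ U) ∧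
      U.card * (blocked (f ∘ π) U B).card ≤
        ((U ×ˢ U).filter fun p => (f p.2, p.1) ∈ B).card := by
  rcases Nat.eq_zero_or_pos U.card with h0 | hpos
  · exact ⟨1, by simp, by simp, by simp [h0]⟩
  obtain ⟨n, hn⟩ : ∃ n, U.card = n + 1 := ⟨U.card - 1, by omega⟩
  let e : U ≃ Fin (n + 1) := U.equivFinOfCardEq hn
  let π : Fin (n + 1) → Equiv.Perm L := fun s =>
    Equiv.Perm.ofSubtype (p := (· ∈ U)) ((e.trans (Equiv.addRight s)).trans e.symm)
  have hin : ∀ s x (hx : x ∈ U), π s x = e.symm (e ⟨x, hx⟩ + s) := fun s x hx => by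
    simp [π, Equiv.Perm.ofSubtype_apply_of_mem, hx]
  have hout : ∀ s, ∀ x ∉ U, π s x = x := fun s x hx =>
    Equiv.Perm.ofSubtype_apply_of_not_mem _ hx
  have hmem : ∀ s x, x ∈ U → π s x ∈ U := fun s x hx => by
    rw [hin s x hx]; exact Subtype.coe_prop _
  -- A pair `(x, y)` of `U` determines the shift taking `x` to `y`, so each blocked pair is counted
  -- for one shift only. There are `U.card` shifts.
  have hsum : ∑ s, (blocked (f ∘ π s) U B).card ≤
      ((U ×ˢ U).filter fun p => (f p.2, p.1) ∈ B).card := by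
    rw [← Finset.card_sigma]
    refine Finset.card_le_card_of_injOn (fun q => (q.2, π q.1 q.2)) ?_ ?_
    · rintro ⟨s, x⟩ hq
      simp only [Finset.coe_sigma, Set.mem_sigma_iff, Finset.mem_coe, blocked, Finset.mem_filter,
        Finset.mem_univ, true_and, Function.comp_apply] at hq
      simp [hq.1, hq.2, hmem s x hq.1]
    · rintro ⟨s, x⟩ hq ⟨s', x'⟩ hq' h
      simp only [Finset.coe_sigma, Set.mem_sigma_iff, Finset.mem_coe, blocked, Finset.mem_filter,
        Finset.mem_univ, true_and, Function.comp_apply] at hq hq'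
      obtain ⟨rfl, h2⟩ := Prod.ext_iff.1 h
      simp only at h2
      rw [hin s _ hq.1, hin s' _ hq'.1, Subtype.coe_inj, e.symm.injective.eq_iff,
        add_right_inj] at h2
      rw [h2]
  obtain ⟨s, -, hs⟩ := Finset.exists_le_of_sum_le (s := (Finset.univ : Finset (Fin (n + 1))))
    (f := fun s => U.card * (blocked (f ∘ π s) U B).card)
    (g := fun _ => ((U ×ˢ U).filter fun p => (f p.2, p.1) ∈ B).card) Finset.univ_nonempty (by
      rw [← Finset.mul_sum, Finset.sum_const, Finset.card_univ, Fintype.card_fin, smul_eq_mul, hn]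
      exact Nat.mul_le_mul_left _ hsum)
  refine ⟨π s, hout s, fun x => ⟨fun h => ?_, hmem s x⟩, hs⟩
  by_contra hx
  rw [hout s x hx] at h
  exact hx h

omit [Fintype C] [Fintype L] [DecidableEq L] in
theorem injOn_of_demand_le_one {f : L → C} {U : Finset L} (h : ∀ c, demand f U c ≤ 1) :
    Set.InjOn f U := fun x hx y hy hxy =>
  Finset.card_le_one.1 (h (f x)) x (by simpa using hx) y (by simpa [hxy] using hy)

-- When each centre lacks at most one leaf, `f` is injective on `U`, so the pairs averaged over in
-- `exists_shift` are distinct dangerous pairs.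
omit [Fintype C] in
theorem Balanced.exists_few_blocked {κ : ℕ} {f : L → C} (hf : Balanced κ f) {U : Finset L}
    (h1 : ∀ c, demand f U c ≤ 1) (B : Finset (C × L)) :
    ∃ f', Balanced κ f' ∧ (∀ x ∉ U, f' x = f x) ∧ (∀ c, demand f' U c = demand f U c) ∧
      U.card * (blocked f' U B).card ≤ (danger f U B).card := by
  obtain ⟨π, hout, hmem, hle⟩ := exists_shift f U B
  refine ⟨f ∘ π, hf.comp_perm π, fun x hx => by simp [hout x hx], demand_comp_perm f π hmem,
    hle.trans ?_⟩
  refine Finset.card_le_card_of_injOn (fun p => (f p.2, p.1)) ?_ ?_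
  · rintro ⟨x, y⟩ hp
    simp only [Finset.mem_coe, Finset.mem_filter, Finset.mem_product] at hp
    simp [danger, hp.2, hp.1.1, demand_pos hp.1.2]
  · rintro ⟨x, y⟩ hp ⟨x', y'⟩ hp' h
    simp only [Finset.mem_coe, Finset.mem_filter, Finset.mem_product] at hp hp'
    obtain ⟨h2, h3⟩ := Prod.ext_iff.1 h
    exact Prod.ext h3 (injOn_of_demand_le_one h1 hp.1.2 hp'.1.2 h2)

/-- Maker owns a complete assignment. -/
def Won (κ : ℕ) (M : Finset (C × L)) : Prop :=
  ∃ f : L → C, Balanced κ f ∧ graphOn f Finset.univ ⊆ M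

/-- Maker completes her stars at once if there are few missing and few blocked pairs. -/
theorem canReply_won {κ a : ℕ} (hκ : 1 ≤ κ) {f : L → C} (hf : Balanced κ f) {U : Finset L}
    {M B : Finset (C × L)} (hM : graphOn f Uᶜ ⊆ M) (hMB : Disjoint M B)
    (ha : U.card + (blocked f U B).card ≤ a)
    (hdeg : ∀ v ∈ U, 1 + ldeg B v + cdeg B (f v) < Fintype.card C) :
    CanReply a M B (Won κ) := by
  have hbl : blocked f Finset.univ B = blocked f U B := by
    refine Finset.Subset.antisymm (fun x hx => ?_)
      (Finset.filter_subset_filter _ (Finset.subset_univ U))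
    have hxB := (Finset.mem_filter.1 hx).2
    refine Finset.mem_filter.2 ⟨?_, hxB⟩
    by_contra hxU
    exact Finset.disjoint_left.1 hMB
      (hM (mem_graphOn.2 ⟨Finset.mem_compl.2 hxU, rfl⟩)) hxB
  have hblU : blocked f U B ⊆ U := Finset.filter_subset _ _
  obtain ⟨f', S, hf', hB, hS, hagree⟩ := hf.exists_unblocked hκ (B := B)
    fun v hv => hdeg v (hblU (hbl ▸ hv))
  rw [hbl] at hS hagree
  have hsub : graphOn f' Finset.univ \ M ⊆ graphOn f' (U ∪ S) := by
    intro p hp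
    obtain ⟨hp1, hp2⟩ := Finset.mem_sdiff.1 hp
    rw [mem_graphOn] at hp1 ⊢
    refine ⟨?_, hp1.2⟩
    by_contra hx
    rw [Finset.mem_union, not_or] at hx
    refine hp2 (hM (mem_graphOn.2 ⟨Finset.mem_compl.2 hx.1, ?_⟩))
    rw [← hagree p.2 fun h => ?_, hp1.2]
    rcases Finset.mem_union.1 h with h | h
    · exact hx.1 (hblU h)
    · exact hx.2 h
  refine ⟨graphOn f' Finset.univ \ M, ?_, Finset.sdiff_disjoint, ?_, fun s' hs' _ _ _ =>
    ⟨f', hf', fun p hp => ?_⟩⟩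
  · have h1 := Finset.card_le_card hsub
    rw [card_graphOn] at h1
    have h2 := Finset.card_union_le U S
    omega
  · rw [Finset.disjoint_left]
    intro p hp
    have := (mem_graphOn.1 (Finset.mem_sdiff.1 hp).1).2
    have h2 := hB p.2
    rwa [this] at h2
  · by_cases h : p ∈ M
    · exact Finset.mem_union_left _ h
    · exact Finset.mem_union_right _ (hs' (Finset.mem_sdiff.2 ⟨hp, h⟩))

/-! ### The last rounds. -/

/-- The position at the end of the middle game. -/
theorem Middle.ready {κ a d r R i : ℕ} {M B b : Finset (C × L)} (h : Middle κ a d r R i M B)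
    (hR : R = r + a * i) (hb : b.card ≤ a) :
    ∃ (f : L → C) (U : Finset L), M = graphOn f Uᶜ ∧ Balanced κ f ∧ U.card = r ∧
      (∀ c, demand f U c ≤ 1) ∧ (danger f U (B ∪ b)).card ≤ a ∧
      -- Two independent leaves `v` and `w`, since the shift may assign to `v` the centre of any
      -- other uncovered leaf.
      ∀ v ∈ U, ∀ w ∈ U, ldeg (B ∪ b) v + cdeg (B ∪ b) (f w) ≤ d + 2 * (a * i + a) := by
  obtain ⟨f, U, G, hM, hf, hcard, hG, hL, hpot⟩ := h
  have hexc : excess f U G = 0 := by unfold potential at hpot; omega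
  have hdan : (danger f U B).card = 0 := by unfold potential at hpot; omega
  have hdem : ∀ c, demand f U c ≤ if c ∈ G then 1 else 0 := fun c => by
    have := (Finset.sum_eq_zero_iff.1 hexc) c (Finset.mem_univ c)
    omega
  refine ⟨f, U, hM, hf, by omega, fun c => ?_, ?_, fun v hv w hw => ?_⟩
  · have := hdem c
    split_ifs at this <;> omega
  · have h1 := potential_union_le f U B b G
    unfold potential at h1
    omega
  · have hwG : f w ∈ G := by
      by_contra hn
      have h1 := hdem (f w)
      have h2 := demand_pos (f := f) hw
      rw [if_neg hn] at h1
      omega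
    have h1 := ldeg_union_le B b v
    have h2 := cdeg_union_le B b (f w)
    have h3 := hL v hv
    have h4 := hG _ hwG
    omega

/-- The last round if fewer than `a` pairs are missing. -/
theorem Middle.canReply_won {κ a d r R i : ℕ} {M B b : Finset (C × L)} (hκ : 1 ≤ κ)
    (h : Middle κ a d r R i M B) (hR : R = r + a * i) (hra : r < a)
    (hC : 1 + (d + 2 * (a * i + a)) < Fintype.card C)
    (hMB : Disjoint M B) (hb : b.card ≤ a) (hMb : Disjoint M b) :
    CanReply a M (B ∪ b) (Won κ) := by
  obtain ⟨f, U, rfl, hf, hU, hdem, hdan, hdeg⟩ := h.ready hR hb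
  obtain ⟨f', hf', hag, hdem', hle⟩ := hf.exists_few_blocked hdem (B ∪ b)
  have hM : graphOn f' Uᶜ = graphOn f Uᶜ := by
    ext p
    simp only [mem_graphOn, Finset.mem_compl]
    refine and_congr_right fun hp => ?_
    rw [hag _ hp]
  refine StarFactor.canReply_won hκ hf' hM.le (Finset.disjoint_union_right.2 ⟨hMB, hMb⟩) ?_
    fun v hv => ?_
  · have h1 : (blocked f' U (B ∪ b)).card ≤ U.card :=
      Finset.card_le_card (Finset.filter_subset _ _)
    generalize (blocked f' U (B ∪ b)).card = e at h1 hle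
    rw [hU] at h1 hle ⊢
    rcases Nat.lt_or_ge e 2 with he | he
    · omega
    -- For `2 ≤ e ≤ r`, `r + e ≤ r * e ≤ a`.
    · have h2 := hle.trans hdan
      nlinarith
  · have hpos : 0 < demand f U (f' v) := hdem' (f' v) ▸ demand_pos hv
    obtain ⟨w, hw⟩ := Finset.card_pos.1 hpos
    obtain ⟨hwU, hwv⟩ := Finset.mem_filter.1 hw
    have := hdeg v hv w hwU
    rw [hwv] at this
    omega

/-- Only one pair is missing for Maker, and it can be replaced by a switch. -/
def Almost (κ a : ℕ) (M B : Finset (C × L)) : Prop :=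
  ∃ (f : L → C) (v : L), Balanced κ f ∧ graphOn f {v}ᶜ ⊆ M ∧
    -- The term `2 * a` allows for Breaker's next move, which may raise either degree by `a`.
    1 + ldeg B v + cdeg B (f v) + 2 * a < Fintype.card C

theorem Almost.canReply {κ a : ℕ} {M B b : Finset (C × L)} (hκ : 1 ≤ κ) (ha : 2 ≤ a)
    (h : Almost κ a M B) (hMB : Disjoint M B) (hb : b.card ≤ a) (hMb : Disjoint M b) :
    CanReply a M (B ∪ b) (Won κ) := by
  obtain ⟨f, v, hf, hM, hdeg⟩ := h
  refine canReply_won hκ hf hM (Finset.disjoint_union_right.2 ⟨hMB, hMb⟩) ?_ fun w hw => ?_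
  · have h1 : (blocked f {v} (B ∪ b)).card ≤ ({v} : Finset L).card :=
      Finset.card_le_card (Finset.filter_subset _ _)
    rw [Finset.card_singleton] at h1 ⊢
    omega
  · rw [Finset.mem_singleton.1 hw]
    have h1 := ldeg_union_le B b v
    have h2 := cdeg_union_le B b (f v)
    omega

/-- The last round but one if exactly `a` pairs are missing. -/
theorem Middle.canReply_almost {κ a d R i : ℕ} {M B b : Finset (C × L)} (ha : 1 ≤ a)
    (h : Middle κ a d a R i M B) (hR : R = a + a * i)
    (hC : 1 + (d + 2 * (a * i + a)) + 2 * a < Fintype.card C)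
    (hMB : Disjoint M B) (hb : b.card ≤ a) (hMb : Disjoint M b) :
    CanReply a M (B ∪ b) fun M' => Almost κ a M' (B ∪ b) := by
  obtain ⟨f, U, rfl, hf, hU, hdem, hdan, hdeg⟩ := h.ready hR hb
  obtain ⟨f', hf', hag, hdem', hle⟩ := hf.exists_few_blocked hdem (B ∪ b)
  have hdisj := Finset.disjoint_union_right.2 ⟨hMB, hMb⟩
  have hbl : (blocked f' U (B ∪ b)).card ≤ 1 := by
    rw [hU] at hle
    exact le_of_mul_le_mul_left (by omega : a * (blocked f' U (B ∪ b)).card ≤ a * 1) ha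
  obtain ⟨v, hvU, hv⟩ : ∃ v ∈ U, ∀ x ∈ U, x ≠ v → (f' x, x) ∉ B ∪ b := by
    rcases (blocked f' U (B ∪ b)).eq_empty_or_nonempty with he | ⟨v, hv⟩
    · obtain ⟨v, hv⟩ := Finset.card_pos.1 (by omega : 0 < U.card)
      refine ⟨v, hv, fun x hx _ hxB => ?_⟩
      exact Finset.notMem_empty x (he ▸ Finset.mem_filter.2 ⟨hx, hxB⟩)
    · refine ⟨v, (Finset.mem_filter.1 hv).1, fun x hx hxv hxB => hxv ?_⟩
      exact Finset.card_le_one.1 hbl x (Finset.mem_filter.2 ⟨hx, hxB⟩) v hv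
  refine ⟨graphOn f' (U.erase v), ?_, ?_, ?_, fun s' hs' _ _ _ => ⟨f', v, hf', fun p hp => ?_, ?_⟩⟩
  · rw [card_graphOn, Finset.card_erase_of_mem hvU]; omega
  · rw [Finset.disjoint_left]
    intro p hp hq
    rw [mem_graphOn] at hp hq
    exact Finset.mem_compl.1 hq.1 (Finset.mem_of_mem_erase hp.1)
  · rw [Finset.disjoint_left]
    intro p hp
    rw [mem_graphOn] at hp
    have := hv p.2 (Finset.mem_of_mem_erase hp.1) (Finset.ne_of_mem_erase hp.1)
    rwa [hp.2] at this
  · rw [mem_graphOn] at hp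
    have hpv : p.2 ≠ v := by simpa using hp.1
    by_cases hpU : p.2 ∈ U
    · exact Finset.mem_union_right _ (hs' (mem_graphOn.2 ⟨Finset.mem_erase.2 ⟨hpv, hpU⟩, hp.2⟩))
    · refine Finset.mem_union_left _ (mem_graphOn.2 ⟨Finset.mem_compl.2 hpU, ?_⟩)
      rw [← hag _ hpU, hp.2]
  · have hpos : 0 < demand f U (f' v) := hdem' (f' v) ▸ demand_pos hvU
    obtain ⟨w, hw⟩ := Finset.card_pos.1 hpos
    obtain ⟨hwU, hwv⟩ := Finset.mem_filter.1 hw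
    have := hdeg v hvU w hwU
    rw [hwv] at this
    omega

/-- Maker can finish in two ways: a star at `f u₁` has one leaf too many, and either of its leaves
`u₁` and `u₂` may go to the centre `f v` of the incomplete star. -/
def Fork (κ : ℕ) (M B : Finset (C × L)) : Prop :=
  ∃ (f : L → C) (v u₁ u₂ : L), Balanced κ f ∧ graphOn f {v}ᶜ ⊆ M ∧ u₁ ≠ u₂ ∧ f u₁ = f u₂ ∧
    f u₁ ≠ f v ∧ (f u₁, v) ∈ M ∧ (f v, u₁) ∉ B ∧ (f v, u₂) ∉ B

-- Breaker's single edge blocks at most one of the two threats. Swapping `v` with the other leaf `u`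
-- makes `(f v, u)` the only pair that can still be missing.
omit [Fintype C] in
theorem Fork.canReply {κ : ℕ} {M B b : Finset (C × L)} (h : Fork κ M B) (hb : b.card ≤ 1) :
    CanReply 1 M (B ∪ b) (Won κ) := by
  obtain ⟨f, v, u₁, u₂, hf, hM, hu, hfu, hne, hvM, hu1, hu2⟩ := h
  obtain ⟨u, hfu', huB⟩ : ∃ u, f u = f u₁ ∧ (f v, u) ∉ B ∪ b := by
    by_contra! hall
    have h1 := hall u₁ rfl
    have h2 := hall u₂ hfu.symm
    rw [Finset.mem_union] at h1 h2
    have := Finset.card_le_one.1 hb _ (h1.resolve_left hu1) _ (h2.resolve_left hu2)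
    exact hu (Prod.ext_iff.1 this).2
  have huv : u ≠ v := fun h => hne (by rw [← hfu', h])
  refine ⟨{(f v, u)} \ M, ?_, Finset.sdiff_disjoint, ?_, fun s' hs' _ _ _ =>
    ⟨f ∘ Equiv.swap u v, hf.comp_perm _, fun p hp => ?_⟩⟩
  · exact (Finset.card_le_card Finset.sdiff_subset).trans (Finset.card_singleton _).le
  · rw [Finset.disjoint_left]
    intro p hp
    rwa [Finset.mem_singleton.1 (Finset.mem_sdiff.1 hp).1]
  · rw [mem_graphOn] at hp
    by_cases hpM : p ∈ M
    · exact Finset.mem_union_left _ hpM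
    refine Finset.mem_union_right _ (hs' (Finset.mem_sdiff.2 ⟨Finset.mem_singleton.2 ?_, hpM⟩))
    by_cases hpu : p.2 = u
    · refine Prod.ext ?_ hpu
      rw [← hp.2, hpu]; simp
    exfalso
    apply hpM
    by_cases hpv : p.2 = v
    · have : p = (f u₁, v) := by
        refine Prod.ext ?_ hpv
        rw [← hp.2, hpv]; simp [hfu']
      rwa [this]
    · refine hM (mem_graphOn.2 ⟨by simpa using hpv, ?_⟩)
      rw [← hp.2]; simp [Equiv.swap_apply_of_ne_of_ne hpu hpv]

/-- The last round but one of the game with bias one. -/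
theorem Middle.canReply_fork {κ d R i : ℕ} {M B b : Finset (C × L)} (hκ : 2 ≤ κ)
    (h : Middle κ 1 d 1 R i M B) (hR : R = 1 + 1 * i)
    (hC : 1 + (d + 2 * (1 * i + 1)) < Fintype.card C) (hb : b.card ≤ 1) :
    CanReply 1 M (B ∪ b) fun M' => Fork κ M' (B ∪ b) := by
  obtain ⟨f, U, rfl, hf, hU, -, -, hdeg⟩ := h.ready hR hb
  obtain ⟨v, rfl⟩ := Finset.card_eq_one.1 hU
  have hv : v ∈ ({v} : Finset L) := Finset.mem_singleton_self v
  have hdeg' := hdeg v hv v hv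
  obtain ⟨c, hc, hcv, hfree⟩ := exists_switch_centre f (B := B ∪ b) (v := v) (c := f v) (by omega)
  -- The two threats are two leaves of the star at `c`, which exist because `κ ≥ 2`.
  obtain ⟨u₁, hu1, u₂, hu2, hu⟩ := Finset.one_lt_card.1 (by rw [← demand, hf c]; exact hκ :
    1 < (Finset.univ.filter fun u => f u = c).card)
  replace hu1 := (Finset.mem_filter.1 hu1).2
  replace hu2 := (Finset.mem_filter.1 hu2).2
  refine ⟨{(c, v)}, by simp, ?_, by simpa using hcv, fun s' hs' _ _ _ =>
    ⟨f, v, u₁, u₂, hf, Finset.subset_union_left, hu, hu1.trans hu2.symm, hu1 ▸ hc, ?_,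
      hfree u₁ hu1, hfree u₂ hu2⟩⟩
  · simp [mem_graphOn]
  · rw [hu1]
    exact Finset.mem_union_right _ (hs' (Finset.mem_singleton_self _))

end StarFactor

namespace StarFactor

section Game

variable {C L : Type*} [Fintype C] [Fintype L] [DecidableEq C] [DecidableEq L]

/-! ### Assembling the phases and choosing the constants. -/

omit [Fintype C] [Fintype L] in
theorem CanReply.mono {a : ℕ} {M B : Finset (C × L)} {I J : Finset (C × L) → Prop}
    (h : CanReply a M B I) (hIJ : ∀ M', I M' → J M') : CanReply a M B J := by
  obtain ⟨s, h1, h2, h3, h4⟩ := h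
  exact ⟨s, h1, h2, h3, fun s' a1 a2 a3 a4 => hIJ _ (h4 s' a1 a2 a3 a4)⟩

/-- Opening, middle game and an endgame `E` of `l` rounds together. -/
theorem makerWinsWithin_of_endgame {α : Type*} [DecidableEq α] {X : Finset α}
    {𝓕 : Set (Finset α)} {a κ d r R s q l : ℕ} (e : C × L ↪ α) (he : ∀ p, e p ∈ X)
    (f₀ : L → C) (hf₀ : Balanced κ f₀) (hκ : 1 ≤ κ) (hr : 1 ≤ r) (hs : 1 ≤ s)
    (hL : Fintype.card L = κ * Fintype.card C) (hcard : a * s + R = Fintype.card L)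
    (hRq : R = r + a * q) (hqκ : κ ≤ q) (hd : Fintype.card C ≤ 4 * d)
    (hRC : R < Fintype.card C) (hR : 2 * ((4 * κ + a) * κ) + a + r ≤ R)
    (E : ℕ → Finset (C × L) → Finset (C × L) → Prop)
    (hE0 : ∀ M B b, Middle κ a d r R q M B → Disjoint M B → b.card ≤ a → Disjoint M b →
      CanReply a M (B ∪ b) fun M' => E 1 M' (B ∪ b))
    (hE : ∀ j, 1 ≤ j → j < l → ∀ M B b, E j M B → Disjoint M B → b.card ≤ a → Disjoint M b →
      CanReply a M (B ∪ b) fun M' => E (j + 1) M' (B ∪ b))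
    (hl : 1 ≤ l) (hwon : ∀ M B, E l M B → Won κ M)
    (h𝓕 : ∀ f : L → C, Balanced κ f → (graphOn f Finset.univ).map e ∈ 𝓕) :
    MakerBreaker.MakerWinsWithin X 𝓕 a a (s + q + l) := by
  let I : ℕ → Finset (C × L) → Finset (C × L) → Prop := fun i M B =>
    if i < s then Opening κ a i M B else
      if i ≤ s + q then Middle κ a d r R (i - s) M B else E (i - (s + q)) M B
  refine MakerBreaker.makerWinsWithin_of_invariant_embedding e he I ?_ ?_ ?_
  · simp only [I]
    rw [if_pos (by omega)]
    exact opening_zero hκ hf₀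
  · intro i hi M B b hI hMB hb hMb
    change CanReply a M (B ∪ b) fun M' => I (i + 1) M' (B ∪ b)
    simp only [I] at hI ⊢
    by_cases h1 : i < s
    · rw [if_pos h1] at hI
      have hmul : a * (i + 1) ≤ a * s := Nat.mul_le_mul_left _ h1
      have hmul' : a * κ ≤ a * q := Nat.mul_le_mul_left _ hqκ
      refine (hI.canReply (by omega) hMB hb hMb).mono fun M' hM' => ?_
      by_cases h2 : i + 1 < s
      · rwa [if_pos h2]
      · rw [if_neg h2, if_pos (by omega)]
        have h3 : i + 1 = s := by omega
        rw [h3, Nat.sub_self]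
        rw [h3] at hM'
        exact hM'.middle hL (by omega) hRC hd hR
    · rw [if_neg h1] at hI
      simp only [if_neg (show ¬ i + 1 < s by omega)]
      by_cases h2 : i < s + q
      · rw [if_pos h2.le] at hI
        simp only [if_pos (show i + 1 ≤ s + q from h2)]
        have h3 : i + 1 - s = i - s + 1 := by omega
        rw [h3]
        have hmul : a * (i - s + 1) ≤ a * q := Nat.mul_le_mul_left _ (by omega)
        exact hI.canReply hr (by omega) hMB hb hMb
      · simp only [if_neg (show ¬ i + 1 ≤ s + q by omega)]
        by_cases h3 : i = s + q
        · subst h3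
          rw [if_pos le_rfl, Nat.add_sub_cancel_left] at hI
          rw [Nat.add_sub_cancel_left]
          exact hE0 M B b hI hMB hb hMb
        · rw [if_neg (by omega)] at hI
          have h4 : i + 1 - (s + q) = i - (s + q) + 1 := by omega
          rw [h4]
          exact hE _ (by omega) (by omega) M B b hI hMB hb hMb
  · intro M B hI
    simp only [I] at hI
    rw [if_neg (by omega), if_neg (by omega), Nat.add_sub_cancel_left] at hI
    obtain ⟨f, hf, hM⟩ := hwon M B hI
    exact ⟨_, h𝓕 f hf, Finset.map_subset_map.2 hM⟩

/-- On a board containing the pairs of a large set of centres and a set of leaves, Maker builds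
a balanced assignment within `|L| / a + 1` rounds. -/
theorem makerWinsWithin_of_large {α : Type*} [DecidableEq α] {X : Finset α}
    {𝓕 : Set (Finset α)} {a κ q : ℕ} (e : C × L ↪ α) (he : ∀ p, e p ∈ X)
    (f₀ : L → C) (hf₀ : Balanced κ f₀) (ha : 1 ≤ a) (hκ : 2 ≤ κ)
    (hL : Fintype.card L = κ * Fintype.card C) (hq : q = 2 * ((4 * κ + a) * κ) + 1)
    (hC : 8 * (a * q) + 16 * a + 12 ≤ Fintype.card C)
    (h𝓕 : ∀ f : L → C, Balanced κ f → (graphOn f Finset.univ).map e ∈ 𝓕) :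
    MakerBreaker.MakerWinsWithin X 𝓕 a a (κ * Fintype.card C / a + 1) := by
  set m := Fintype.card C with hm
  -- The remainder is taken in `1, …, a` instead of `0, …, a - 1`, so that something is always left
  -- for the endgame; `r = a` is the divisible case.
  obtain ⟨p, r, hr, hra, hpr⟩ : ∃ p r, 1 ≤ r ∧ r ≤ a ∧ a * p + r = κ * m := by
    have h1 := Nat.div_add_mod (κ * m - 1) a
    have h2 := Nat.mod_lt (κ * m - 1) ha
    have h3 : 1 * 1 ≤ κ * m := Nat.mul_le_mul (by omega) (by omega)
    exact ⟨(κ * m - 1) / a, (κ * m - 1) % a + 1, by omega, by omega, by omega⟩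
  have hκm : 1 * m ≤ κ * m := Nat.mul_le_mul_right _ (by omega)
  have hqp : q < p := by
    have : a * q < a * p := by omega
    exact lt_of_mul_lt_mul_left this (Nat.zero_le a)
  obtain ⟨s, rfl⟩ : ∃ s, p = s + q := ⟨p - q, by omega⟩
  have hmul : a * (s + q) = a * s + a * q := by ring
  have hκq : κ ≤ q := by
    have : 1 * κ ≤ (4 * κ + a) * κ := Nat.mul_le_mul_right _ (by omega)
    omega
  have haq : 2 * ((4 * κ + a) * κ) + a ≤ a * q := by
    have : 1 * (2 * ((4 * κ + a) * κ)) ≤ a * (2 * ((4 * κ + a) * κ)) :=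
      Nat.mul_le_mul_right _ ha
    rw [hq, mul_add]
    omega
  -- `d` is `m / 4` rounded up, leaving ample room for switches. The `q` middle rounds are just long
  -- enough to absorb an initial potential of `2 * ((4 * κ + a) * κ)`, independently of `m`.
  have key := fun l E => makerWinsWithin_of_endgame (𝓕 := 𝓕) (a := a) (d := (m + 3) / 4) (r := r)
    (R := r + a * q) (s := s) (q := q) (l := l) e he f₀ hf₀ (by omega) hr (by omega) hL (by omega)
    rfl hκq (by omega) (by omega) (by omega) E
  rcases hra.lt_or_eq with hlt | rfl
  · have ht : κ * m / a = s + q := by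
      rw [← hpr, Nat.mul_add_div ha, Nat.div_eq_of_lt hlt, add_zero]
    rw [ht]
    refine key 1 (fun _ M _ => Won κ M) (fun M B b h hMB hb hMb => ?_)
      (fun j h1 h2 => by omega) le_rfl (fun _ _ h => h) h𝓕
    exact h.canReply_won (by omega) rfl hlt (by omega) hMB hb hMb
  · have ht : κ * m / r + 1 = s + q + 2 := by
      rw [← hpr, Nat.mul_add_div ha, Nat.div_self ha]
    rw [ht]
    rcases Nat.lt_or_ge r 2 with h2 | h2
    · obtain rfl : r = 1 := by omega
      refine key 2 (fun j M B => if j = 1 then Fork κ M B else Won κ M)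
        (fun M B b h hMB hb hMb => ?_) (fun j h1 h2 M B b h hMB hb hMb => ?_) (by omega)
        (fun _ _ h => by simpa using h) h𝓕
      · simpa using h.canReply_fork hκ rfl (by omega) hb
      · obtain rfl : j = 1 := by omega
        simpa using Fork.canReply (by simpa using h) hb
    · refine key 2 (fun j M B => if j = 1 then Almost κ r M B else Won κ M)
        (fun M B b h hMB hb hMb => ?_) (fun j h1 h2' M B b h hMB hb hMb => ?_) (by omega)
        (fun _ _ h => by simpa using h) h𝓕
      · simpa using h.canReply_almost ha rfl (by omega) hMB hb hMb
      · obtain rfl : j = 1 := by omega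
        simpa using Almost.canReply (by omega) h2 (by simpa using h) hMB hb hMb

end Game

section Board

variable {C L V : Type*} [Fintype L] [DecidableEq C] [DecidableEq L]

/-! ### From assignments to star factors of the complete graph. -/

/-- The edge between a centre and a leaf. -/
def pairEdge (ψ : V ≃ C ⊕ L) : C × L ↪ Sym2 V where
  toFun p := s(ψ.symm (Sum.inl p.1), ψ.symm (Sum.inr p.2))
  inj' := by
    rintro ⟨c, v⟩ ⟨c', v'⟩ h
    simpa using h

omit [Fintype L] [DecidableEq C] [DecidableEq L] in
theorem pairEdge_apply (ψ : V ≃ C ⊕ L) (p : C × L) :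
    pairEdge ψ p = s(ψ.symm (Sum.inl p.1), ψ.symm (Sum.inr p.2)) := rfl

omit [Fintype L] [DecidableEq C] [DecidableEq L] in
theorem pairEdge_mem (ψ : V ≃ C ⊕ L) (p : C × L) :
    pairEdge ψ p ∈ (⊤ : SimpleGraph V).edgeSet := by
  simp [pairEdge_apply]

/-- A balanced assignment of the leaves to the centres is a star factor. -/
theorem isFactorEdgeSet_of_balanced {m k : ℕ} (ψ : V ≃ Fin m ⊕ L) {f : L → Fin m}
    (hf : Balanced (k - 1) f) :
    IsFactorEdgeSet (starS k) (⊤ : SimpleGraph V)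
      ((graphOn f Finset.univ).map (pairEdge ψ)) := by
  have g : ∀ c, {v // f v = c} ≃ Fin (k - 1) := fun c =>
    Fintype.equivFinOfCardEq ((Fintype.card_subtype _).trans (hf c))
  let φ : Fin m → Fin 1 ⊕ Fin (k - 1) → Fin m ⊕ L := fun c =>
    Sum.elim (fun _ => Sum.inl c) fun j => Sum.inr ((g c).symm j).1
  have hφ : Function.Bijective fun p : Fin m × (Fin 1 ⊕ Fin (k - 1)) => φ p.1 p.2 := by
    constructor
    · rintro ⟨c, x | x⟩ ⟨c', y | y⟩ h
      · have hc : c = c' := by simpa [φ] using h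
        rw [hc, Subsingleton.elim x y]
      · simp [φ] at h
      · simp [φ] at h
      · have h1 : ((g c).symm x).1 = ((g c').symm y).1 := by simpa [φ] using h
        have hc : c = c' := by
          rw [← ((g c).symm x).2, ← ((g c').symm y).2, h1]
        subst hc
        rw [(g c).symm.injective (Subtype.ext h1)]
    · rintro (c | v)
      · exact ⟨(c, Sum.inl 0), rfl⟩
      · exact ⟨(f v, Sum.inr (g (f v) ⟨v, rfl⟩)), by simp [φ]⟩
  have hinj : ∀ c, Function.Injective (φ c) := fun c x y h =>
    (Prod.ext_iff.1 (hφ.1 (a₁ := (c, x)) (a₂ := (c, y)) h)).2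
  let F : Fin m → SimpleGraph.Copy (starS k) (⊤ : SimpleGraph V) := fun c =>
    ⟨⟨fun x => ψ.symm (φ c x), fun {x y} hxy => by
      rw [SimpleGraph.top_adj]
      exact fun h => hxy.ne (hinj c (ψ.symm.injective h))⟩,
      ψ.symm.injective.comp (hinj c)⟩
  have hF : ∀ c x, F c x = ψ.symm (φ c x) := fun _ _ => rfl
  refine ⟨m, F, ψ.symm.bijective.comp hφ, ?_⟩
  ext x
  simp only [Finset.coe_map, Set.mem_image, Finset.mem_coe, mem_graphOn, Finset.mem_univ,
    true_and, Set.mem_iUnion]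
  constructor
  · rintro ⟨⟨c, v⟩, hv, rfl⟩
    simp only at hv
    subst hv
    refine ⟨f v, s(Sum.inl 0, Sum.inr (g (f v) ⟨v, rfl⟩)), by simp, ?_⟩
    simp [hF, φ, pairEdge_apply]
  · rintro ⟨c, y, hy, rfl⟩
    induction y using Sym2.ind with
    | _ x y =>
      rw [SimpleGraph.mem_edgeSet, completeBipartiteGraph_adj] at hy
      rcases x with x | x <;> rcases y with y | y
      · simp at hy
      · exact ⟨(c, ((g c).symm y).1), ((g c).symm y).2, by simp [hF, φ, pairEdge_apply]⟩
      · exact ⟨(c, ((g c).symm x).1), ((g c).symm x).2, by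
          simp [hF, φ, pairEdge_apply, Sym2.eq_swap]⟩
      · simp at hy

end Board

theorem balanced_fst (m κ : ℕ) : Balanced κ (Prod.fst : Fin m × Fin κ → Fin m) := fun c => by
  have : (Finset.univ.filter fun v : Fin m × Fin κ => v.1 = c) = {c} ×ˢ Finset.univ := by
    ext v; simp only [Finset.mem_filter, Finset.mem_univ, true_and, Finset.mem_product,
      Finset.mem_singleton, and_true]
  rw [demand, this]
  simp

theorem starFactorDuration_le {a k m : ℕ} (ha : 1 ≤ a) (hk : 3 ≤ k)
    (hm : 8 * (a * (2 * ((4 * (k - 1) + a) * (k - 1)) + 1)) + 16 * a + 12 ≤ m) :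
    starFactorDuration (k * m) k a ≤ (((k - 1) * m / a + 1 : ℕ) : ℕ∞) := by
  have hcard : Fintype.card (Fin (k * m)) = Fintype.card (Fin m ⊕ Fin m × Fin (k - 1)) := by
    obtain ⟨j, rfl⟩ : ∃ j, k = j + 1 := ⟨k - 1, by omega⟩
    simp only [Fintype.card_fin, Fintype.card_sum, Fintype.card_prod, Nat.add_sub_cancel]
    ring
  let ψ := Fintype.equivOfCardEq hcard
  have h := makerWinsWithin_of_large (C := Fin m) (L := Fin m × Fin (k - 1))
    (X := (⊤ : SimpleGraph (Fin (k * m))).edgeFinset)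
    (𝓕 := {E | IsFactorEdgeSet (starS k) (⊤ : SimpleGraph (Fin (k * m))) E}) (pairEdge ψ)
    (fun p => SimpleGraph.mem_edgeFinset.2 (pairEdge_mem ψ p)) _ (balanced_fst m (k - 1)) ha
    (by omega) (by simp [mul_comm]) rfl (by simpa using hm)
    fun f hf => isFactorEdgeSet_of_balanced ψ hf
  rw [Fintype.card_fin] at h
  exact iInf₂_le _ h

end StarFactor

theorem mainTheorem6 (a k : ℕ) (ha : 1 ≤ a) (hk : 3 ≤ k) :
    ∃ n₀ : ℕ, ∀ n : ℕ, n₀ ≤ n → k ∣ n →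
      (¬ a ∣ (k - 1) * n / k →
        starFactorDuration n k a ≤ (⌈(((k : ℚ) - 1) * n) / (k * a)⌉₊ : ℕ∞)) ∧
      (a ∣ (k - 1) * n / k →
        starFactorDuration n k a ≤ (((k - 1) * n / (k * a) + 1 : ℕ) : ℕ∞)) := by
  refine ⟨k * (8 * (a * (2 * ((4 * (k - 1) + a) * (k - 1)) + 1)) + 16 * a + 12), ?_⟩
  rintro n hn ⟨m, rfl⟩
  have hk0 : 0 < k := by omega
  have h := StarFactor.starFactorDuration_le ha hk (Nat.le_of_mul_le_mul_left hn hk0)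
  have hN : (k - 1) * (k * m) = k * ((k - 1) * m) := by ring
  have hdiv : (k - 1) * (k * m) / k = (k - 1) * m := by rw [hN, Nat.mul_div_cancel_left _ hk0]
  rw [hdiv]
  refine ⟨fun hnd => h.trans ?_, fun _ => ?_⟩
  -- When `a` does not divide the number of edges, the floor plus one is at most the ceiling.
  · rw [Nat.cast_le, Nat.succ_le_iff, Nat.lt_ceil]
    have hq : ((k : ℚ) - 1) * ((k * m : ℕ) : ℚ) / (k * a) = (((k - 1) * m : ℕ) : ℚ) / a := by
      have hk' : (k : ℚ) ≠ 0 := by positivity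
      have ha' : (a : ℚ) ≠ 0 := by positivity
      push_cast [Nat.cast_sub (by omega : 1 ≤ k)]
      field_simp
    rw [hq, lt_div_iff₀ (by exact_mod_cast ha)]
    have hlt : (k - 1) * m / a * a < (k - 1) * m := lt_of_le_of_ne (Nat.div_mul_le_self _ _)
      fun he => hnd (Dvd.intro_left _ he)
    exact_mod_cast hlt
  · rwa [hN, Nat.mul_div_mul_left _ _ hk0]
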